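/- **Fully online matching.** An instance is a finite undirected graph $G=(V,E)$ with a sequence of $2|V|$ steps in which every vertex has one arrival and, later, one deadline, such that all neighbors of $u$ arrive before $u$'s deadline. A vertex can be matched from its arrival up to its deadline, and decisions are irrevocable. An edge is revealed once both its endpoints have arrived. **Balanced Ranking.** Let $f,g:[0,1]\to[0,1]$, where $f$ is nondecreasing and $1$-Lipschitz and $g$ satisfies $g(a)-g(b)\ge \frac{a-b}{100}$ for all $0\le b\le a\le 1$. Every vertex $u$ independently draws a rank $y_u\in[0,1]$ uniformly at random on its arrival. At the deadline of a vertex $u$ that is still unmatched and has an available neighbor (one that has arrived, whose deadline has not passed, and that is unmatched), the algorithm matches $u$ to the available neighbor $v$ with the largest offer $1-g(y_v)-f(x_v^{(u)})$ (ties have probability zero). Here the lookahead water level $x_v^{(u)}$ is the probability, over all ranks, that $v$ is matched right after $u$'s deadline in the execution of this same algorithm; the levels $x^{(u)}_v$, $v\in V$, are thus defined by a fixed-point condition that involves only the steps up to $u$'s deadline. **Theorem.** There are functions $f$ and $g$ as above, with $f(1)+g(1)\le 1$, such that on every fully online matching instance whose graph is bipartite Balanced Ranking with $f$ and $g$ is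 well defined (the lookahead water levels exist and are unique) and $0.569$-competitive: the expected size of its matching is at least $0.569$ times the size of a maximum matching of $G$. -/

import Mathlib

open MeasureTheory

/-- The two kinds of steps of a fully online matching instance. -/
inductive OnlineEvent (V : Type*) where
  | arrival (u : V) : OnlineEvent V
  | deadline (u : V) : OnlineEvent V

/-- A fully online matching instance: a graph together with a chronological list in which every
vertex arrives exactly once and has its deadline exactly once (so there are `2 |V|` steps), every
vertex arrives before its own deadline, and all neighbors of `u` arrive before `u`'s deadline.
For a list without repetitions, `[a, b].Sublist l` says that `a` occurs before `b`. -/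
structure FullyOnlineInstance (V : Type*) where
  graph : SimpleGraph V
  events : List (OnlineEvent V)
  nodup : events.Nodup
  complete : ∀ e, e ∈ events
  arrival_before_deadline : ∀ u : V,
    [OnlineEvent.arrival u, OnlineEvent.deadline u].Sublist events
  neighbor_before_deadline : ∀ u v : V, graph.Adj u v →
    [OnlineEvent.arrival v, OnlineEvent.deadline u].Sublist events

/-- The state of an integral algorithm: the vertices that have arrived and whose deadlines have
not passed, and the edges matched so far. -/
structure MatchState (V : Type*) where
  present : Finset V
  matching : Finset (Sym2 V)

namespace MatchState

variable {V : Type*}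

/-- The state before the first step. -/
def init : MatchState V := ⟨∅, ∅⟩

/-- `v` is an endpoint of an edge matched so far. -/
def IsMatched (S : MatchState V) (v : V) : Prop := ∃ e ∈ S.matching, v ∈ e

open Classical in
/-- The available (present and unmatched) neighbors of `u`. -/
noncomputable def available (G : SimpleGraph V) (S : MatchState V) (u : V) : Finset V :=
  S.present.filter fun v => G.Adj u v ∧ ¬ S.IsMatched v

open Classical in
/-- The available neighbors of `u` that make the largest offer. -/
noncomputable def bestOffers (G : SimpleGraph V) (S : MatchState V) (u : V) (offer : V → ℝ) :
    Finset V :=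
  (S.available G u).filter fun v => ∀ w ∈ S.available G u, offer w ≤ offer v

open Classical in
/-- Arrival of `u`. -/
noncomputable def arrive (S : MatchState V) (u : V) : MatchState V :=
  ⟨insert u S.present, S.matching⟩

open Classical in
/-- Deadline of `u`: if `u` is still unmatched and has an available neighbor, it is matched to an
available neighbor making the largest offer; then `u` departs. A tie is broken by a choice that
depends only on the set of the tied vertices. -/
noncomputable def depart (G : SimpleGraph V) (S : MatchState V) (u : V) (offer : V → ℝ) :
    MatchState V :=
  ⟨S.present.erase u,
    if h : ¬ S.IsMatched u ∧ (S.bestOffers G u offer).Nonempty then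
      insert s(u, h.2.choose) S.matching
    else S.matching⟩

end MatchState

namespace BalancedRanking

variable {V : Type*}

/-- One step of Balanced Ranking with functions `f`, `g`, lookahead water levels `x`
(`x u v` is the water level of `v` right after the deadline of `u`) and ranks `y`. -/
noncomputable def step (G : SimpleGraph V) (f g : ℝ → ℝ) (x : V → V → ℝ) (y : V → ℝ)
    (S : MatchState V) : OnlineEvent V → MatchState V
  | .arrival u => S.arrive u
  | .deadline u => S.depart G u fun v => 1 - g (y v) - f (x u v)

/-- The state of Balanced Ranking after a list of steps. It depends on `x` only through the values
`x u v` such that the deadline of `u` is in the list. -/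
noncomputable def run (G : SimpleGraph V) (f g : ℝ → ℝ) (x : V → V → ℝ) (y : V → ℝ)
    (l : List (OnlineEvent V)) : MatchState V :=
  l.foldl (step G f g x y) MatchState.init

/-- The law of the ranks: independent and uniform on `[0, 1]`. -/
noncomputable def rankMeasure (V : Type*) [Fintype V] : Measure (V → ℝ) :=
  Measure.pi fun _ => volume.restrict (Set.Icc (0 : ℝ) 1)

/-- `x` are the lookahead water levels of Balanced Ranking on `I`: for all `u` and `v`, `x u v` is
the probability that `v` is matched right after `u`'s deadline, when Balanced Ranking is run with
these very levels. The equations for `u` involve only `x u` and the levels `x w` at the earlier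
deadlines, and only the edges at vertices whose deadline is not later than that of `u`. -/
def IsLookahead [Fintype V] (f g : ℝ → ℝ) (I : FullyOnlineInstance V) (x : V → V → ℝ) : Prop :=
  ∀ (u : V) (past future : List (OnlineEvent V)),
    I.events = past ++ OnlineEvent.deadline u :: future →
      ∀ v : V, x u v = (rankMeasure V).real
        {y | (run I.graph f g x y (past ++ [OnlineEvent.deadline u])).IsMatched v}

/-- The expected number of edges matched by Balanced Ranking. -/
noncomputable def expectedSize [Fintype V] (f g : ℝ → ℝ) (I : FullyOnlineInstance V)
    (x : V → V → ℝ) : ℝ :=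
  ∫ y, ((run I.graph f g x y I.events).matching.card : ℝ) ∂(rankMeasure V)

/-- The functions with which Balanced Ranking is run: `f, g : [0, 1] → [0, 1]`, with `f`
nondecreasing and `1`-Lipschitz, `g` increasing and `1/100`-reverse Lipschitz, and nonnegative
offers. -/
structure Admissible (f g : ℝ → ℝ) : Prop where
  f_mapsTo : Set.MapsTo f (Set.Icc 0 1) (Set.Icc 0 1)
  g_mapsTo : Set.MapsTo g (Set.Icc 0 1) (Set.Icc 0 1)
  f_mono : MonotoneOn f (Set.Icc 0 1)
  f_lipschitz : ∀ a ∈ Set.Icc (0 : ℝ) 1, ∀ b ∈ Set.Icc (0 : ℝ) 1, b ≤ a → f a - f b ≤ a - b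
  g_reverseLipschitz : ∀ a ∈ Set.Icc (0 : ℝ) 1, ∀ b ∈ Set.Icc (0 : ℝ) 1, b ≤ a →
    (a - b) / 100 ≤ g a - g b
  boundary : f 1 + g 1 ≤ 1

end BalancedRanking

/-! The proof is a randomized primal-dual argument. When `z` is matched to `w` at the deadline of
`z`, one unit is split: `w` receives `g (y w) + f (x z w)` and `z` receives the offer, which is the
rest. The gains add up to the size of the matching. By weak duality it therefore suffices that on
every edge `u v` the two expected gains sum to at least 0.569 (`edge_bound`,
`mul_ncard_le_sum_of_matching`). Let `u` be the endpoint with the earlier deadline; passive gains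
are counted only up to that deadline.

Water levels. The lookahead level is the probability of being matched right after the step, and `f`
is nondecreasing. So the expected part of the gain coming from `f` is at least `F` of the current
level, where `F` is the primitive of `f`. For `v` the value `F b` is kept, with `b = x u v`. For
`u`, convexity replaces `F` by its tangent at 2/5, which can be charged pointwise to the event that
`u` is matched.

Ranks. Fix all ranks except `s = y u` and `t = y v`, and compare with the run in which `u` and `v`
are absent. In a bipartite graph, adding a vertex changes the availability of at most one vertex at
any time: on its own side a vertex can only become available, on the other side only unavailable
(`extraAtMost_freeRun`). Hence, if `u` wins some earlier contest in the run without both, it is also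
matched early in the true run; and if it wins none, its best alternative offer `σ` survives for as
long as `u` itself is free. The rank `s` decides through a threshold `γ` whether `u` wins early; `t`
decides through a threshold `β` whether `v` does, and through another one whether `v` beats `σ` at
the deadline of `u` (`pair_cases`). Integrating over `s` and `t` (`pair_bound`) leaves a numerical
inequality in five parameters, `ratio_bound`.

Well-definedness. At each deadline the levels are a fixed point of a continuous map. Raising one
level only helps the other vertices. Minimality of the coordinate sum gives existence, and comparing
the set where one solution exceeds another gives uniqueness (`exists_row`, `row_le_of_fixed`). -/

namespace BalancedRanking

/-! ### Numerical estimates: the factor-revealing inequality. -/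

/-- The density `g - 1/25`: a hyperbola followed by a line. -/
noncomputable def gainSlope (y : ℝ) : ℝ :=
  if y < 2 / 5 then 63 / 200 / (1 - y) else 297 / 1000 + 57 / 100 * y

/-- The primitive of `gainSlope` on `[0, 1]`. -/
noncomputable def gainPrimitive (y : ℝ) : ℝ :=
  if y < 2 / 5 then -(63 / 200) * Real.log (1 - y)
  else -(63 / 200) * Real.log (3 / 5) + 525 / 1000 * (y - 2 / 5) + 285 / 1000 * (y - 2 / 5) ^ 2

theorem neg_log_three_fifths : (5108 / 10000 : ℝ) ≤ -Real.log (3 / 5) := by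
  -- At 1/4 the quotient (1 + x) / (1 - x) is 5/3; three terms of the positive series are enough.
  have h := Real.hasSum_log_sub_log_of_abs_lt_one (x := 1 / 4) (by norm_num [abs_lt])
  have h1 := sum_le_hasSum (Finset.range 3) (fun i _ => by positivity) h
  have h2 : Real.log (1 + 1 / 4) - Real.log (1 - 1 / 4) = -Real.log (3 / 5) := by
    rw [← Real.log_div (by norm_num) (by norm_num), ← Real.log_inv]; norm_num
  rw [h2] at h1
  norm_num [Finset.sum_range_succ] at h1 ⊢
  linarith

/-- Quadratic Taylor bound for `-log` at `3/5`, valid on the left. -/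
theorem neg_log_lower_left {q : ℝ} (hq : 0 < q) (hq' : q ≤ 3 / 5) :
    5108 / 10000 - (q - 3 / 5) / (3 / 5) + (q - 3 / 5) ^ 2 * (25 / 18) ≤ -Real.log q := by
  have anti : AntitoneOn (fun q : ℝ => -Real.log q + (q - 3 / 5) / (3 / 5)
      - (q - 3 / 5) ^ 2 * (25 / 18)) (Set.Icc q (3 / 5)) := by
    have hd : ∀ z ∈ Set.Icc q (3 / 5 : ℝ), HasDerivAt (fun q : ℝ => -Real.log q
        + (q - 3 / 5) / (3 / 5) - (q - 3 / 5) ^ 2 * (25 / 18))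
        (-z⁻¹ + 1 / (3 / 5) - (2 * (z - 3 / 5)) * (25 / 18)) z := by
      intro z hz
      have hz0 : z ≠ 0 := (lt_of_lt_of_le hq hz.1).ne'
      have e := ((hasDerivAt_id z).sub_const (3 / 5))
      have := ((Real.hasDerivAt_log hz0).neg.add (e.div_const (3 / 5))).sub
        ((e.pow 2).mul_const (25 / 18))
      exact this.congr_deriv (by norm_num)
    refine antitoneOn_of_deriv_nonpos (convex_Icc _ _)
      (fun z hz => (hd z hz).continuousAt.continuousWithinAt)
      (fun z hz => (hd z (interior_subset hz)).differentiableAt.differentiableWithinAt)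
      fun z hz => ?_
    rw [interior_Icc] at hz
    rw [(hd z ⟨hz.1.le, hz.2.le⟩).deriv]
    have hz0 : 0 < z := hq.trans hz.1
    -- The subtracted polynomial agrees with `-log` to second order at 3/5, so the derivative of the
    -- difference is a square up to a factor of constant sign.
    have : -z⁻¹ + 1 / (3 / 5) - (2 * (z - 3 / 5)) * (25 / 18)
        = -((z - 3 / 5) ^ 2 * (25 / 9)) / z := by field_simp; ring
    rw [this]
    exact div_nonpos_of_nonpos_of_nonneg (neg_nonpos.2 (by positivity)) hz0.le
  have := anti ⟨le_rfl, hq'⟩ ⟨hq', le_rfl⟩ hq'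
  norm_num at this
  have h := neg_log_three_fifths
  norm_num at h
  linarith

/-- The point 3/5 is critical for -(63/200) log q + (525/1000) q, the function governing the nearly
tight case of the ratio bound. To its right the remaining term k (q - 3/5) is nonnegative and this
tangent is enough; to its left the quadratic bound is needed to absorb that term. -/
theorem neg_log_lower {q : ℝ} (hq : 0 < q) :
    5108 / 10000 - (q - 3 / 5) / (3 / 5) ≤ -Real.log q := by
  have h1 := Real.log_le_sub_one_of_pos (x := q / (3 / 5)) (by positivity)
  rw [Real.log_div hq.ne' (by norm_num)] at h1
  have := neg_log_three_fifths
  have e : (q - 3 / 5) / (3 / 5) = q / (3 / 5) - 1 := by ring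
  linarith

theorem neg_log_one_sub_lower {y : ℝ} (hy : 0 ≤ y) (hy1 : y < 1) :
    y + y ^ 2 / 2 ≤ -Real.log (1 - y) := by
  have h := Real.hasSum_pow_div_log_of_abs_lt_one (x := y) (by rwa [abs_of_nonneg hy])
  have h1 := sum_le_hasSum (Finset.range 2) (fun i _ => by positivity) h
  norm_num [Finset.sum_range_succ] at h1
  linarith

theorem gainPrimitive_of_ge {y : ℝ} (hy : 2 / 5 ≤ y) :
    160902 / 1000000 + 525 / 1000 * (y - 2 / 5) + 285 / 1000 * (y - 2 / 5) ^ 2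
      ≤ gainPrimitive y := by
  rw [gainPrimitive, if_neg (not_lt.2 hy)]
  have := neg_log_three_fifths
  linarith

theorem gainPrimitive_lower {y : ℝ} (hy : 0 ≤ y) :
    63 / 200 * y + 63 / 400 * y ^ 2 ≤ gainPrimitive y := by
  rcases lt_or_ge y (2 / 5) with h | h
  · rw [gainPrimitive, if_pos h]
    have := neg_log_one_sub_lower hy (by linarith)
    linarith
  · refine le_trans ?_ (gainPrimitive_of_ge h)
    nlinarith

/-- Case of a small rank threshold `τ`, or of a large alternative offer. -/
theorem ratio_small {γ β k : ℝ} (hγ : 0 ≤ γ) (hγ1 : γ ≤ 1) (hβ : 0 ≤ β) (hβ1 : β ≤ 2 / 5)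
    (hk : 0 ≤ k) :
    569 / 1000 ≤ 8 / 100 * γ + gainPrimitive γ + gainPrimitive β
      + (1 - γ) * (605 / 1000 + k - β * (525 / 1000 + k))
      + (16 / 1000 - 8 / 10 * k + 5 * k ^ 2) := by
  rcases lt_or_ge γ (2 / 5) with hγ2 | hγ2
  -- On the hyperbola both primitives are logarithms, and the whole expression depends on γ and β
  -- only through q = (1 - γ)(1 - β).
  · have hlog : -(63 / 200) * Real.log ((1 - γ) * (1 - β)) ≤ gainPrimitive γ + gainPrimitive β := by
      rw [Real.log_mul (by linarith) (by linarith)]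
      rw [gainPrimitive, if_pos hγ2, gainPrimitive]
      split_ifs with h
      · linarith
      · have : β = 2 / 5 := by linarith
        subst this
        norm_num
        linarith
    set q := (1 - γ) * (1 - β) with hq
    have e : (1 - γ) * (605 / 1000 + k - β * (525 / 1000 + k))
        = q * (525 / 1000 + k) + 8 / 100 * (1 - γ) := by rw [hq]; ring
    have hq0 : 0 < q := mul_pos (by linarith) (by linarith)
    rw [e]
    rcases le_or_gt q (3 / 5) with h | h
    · have := neg_log_lower_left hq0 h
      nlinarith [sq_nonneg (k + 7 / 8 * (q - 3 / 5)), sq_nonneg (k - 24 / 1000)]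
    · have := neg_log_lower hq0
      nlinarith [sq_nonneg (k - 2 / 100), mul_nonneg hk (sub_nonneg.2 h.le)]
  · have h1 := gainPrimitive_of_ge hγ2
    have h2 := gainPrimitive_lower hβ
    obtain ⟨e, rfl⟩ : ∃ e, γ = 2 / 5 + e := ⟨γ - 2 / 5, by ring⟩
    have he : 0 ≤ e := by linarith
    have hb : β * k * e ≥ 0 := by positivity
    have : 0 ≤ e * β := by positivity
    nlinarith [sq_nonneg (k - 57 / 100 * (e + 6 / 10 * β)), sq_nonneg (k - 243 / 10000),
      sq_nonneg β]

/-- The case of a late threshold β and an alternative offer of at least 395/1000, with τ already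
moved down to its worst value β. -/
theorem ratio_large_offer {γ β k : ℝ} (hγ : 0 ≤ γ) (hγ1 : γ ≤ 1) (hβ : 2 / 5 ≤ β) (hβ1 : β ≤ 1)
    (hk : 0 ≤ k) (hk1 : k ≤ 1 / 25) :
    569 / 1000 ≤ 8 / 100 * γ + gainPrimitive γ + gainPrimitive β
      + (1 - γ) * ((1 - β) * (92 / 100 + k - (297 / 1000 + 57 / 100 * β)) + 395 / 1000 * β)
      + (16 / 1000 - 8 / 10 * k + 5 * k ^ 2) := by
  have h1 := gainPrimitive_lower hγ
  have h2 := gainPrimitive_of_ge hβ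
  obtain ⟨x, rfl⟩ : ∃ x, β = 2 / 5 + x := ⟨β - 2 / 5, by ring⟩
  have hx : 0 ≤ x := by linarith
  have e : (1 - γ) * ((1 - (2 / 5 + x)) * (92 / 100 + k - (297 / 1000 + 57 / 100 * (2 / 5 + x)))
      + 395 / 1000 * (2 / 5 + x)) = (1 - γ) * (395 / 1000) + (1 - γ) * (6 / 10 * k)
      - (1 - γ) * ((342 / 1000 + k) * x) + (1 - γ) * (57 / 100 * x ^ 2) := by ring
  rw [e]
  have a1 : (1 - γ) * ((342 / 1000 + k) * x) ≤ 382 / 1000 * x := by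
    have : (342 / 1000 + k) * x ≤ 382 / 1000 * x := by gcongr; linarith
    have h0 : 0 ≤ (342 / 1000 + k) * x := by positivity
    nlinarith
  have a2 : 0 ≤ (1 - γ) * (57 / 100 * x ^ 2) := mul_nonneg (by linarith) (by positivity)
  nlinarith [sq_nonneg (γ - 1905 / 1000 * k), sq_nonneg (k - 225 / 10000), sq_nonneg x]

theorem ratio_small_offer_late {γ β x k : ℝ} (hγ : 0 ≤ γ) (hγ1 : γ ≤ 1) (hβ : 0 ≤ β) (hβτ : β ≤ 2 / 5 + x)
    (hk : 0 ≤ k) (hβ2 : 2 / 5 ≤ β) :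
    569 / 1000 ≤ 8 / 100 * γ + gainPrimitive γ + gainPrimitive β
      + (1 - γ) * (92 / 100 + k - (1 - (2 / 5 + x) + β) * (297 / 1000 + 57 / 100 * (2 / 5 + x)))
      + (16 / 1000 - 8 / 10 * k + 5 * k ^ 2) := by
  have h1 := gainPrimitive_lower hγ
  have h2 := gainPrimitive_of_ge hβ2
  obtain ⟨w, rfl⟩ : ∃ w, β = 2 / 5 + w := ⟨β - 2 / 5, by ring⟩
  have hw : 0 ≤ w := by linarith
  have hwx : w ≤ x := by linarith
  -- The right side is affine in γ, so it suffices to check γ = 0 (`k0`) and γ = 1 (`k1`).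
  have key : -(29 / 10000) ≤ (1 - γ) * (-(45 / 1000) * x + 57 / 100 * x ^ 2 - 57 / 100 * x * w)
      + 525 / 1000 * γ * w + 285 / 1000 * w ^ 2 := by
    have k0 : -(29 / 10000) ≤ -(45 / 1000) * x + 57 / 100 * x ^ 2 - 57 / 100 * x * w
        + 285 / 1000 * w ^ 2 := by
      nlinarith [sq_nonneg (x - w), sq_nonneg (x - 79 / 1000)]
    have k1 : 0 ≤ 525 / 1000 * w + 285 / 1000 * w ^ 2 := by positivity
    nlinarith
  nlinarith [sq_nonneg (γ - 32 / 10 * k), sq_nonneg k]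

/-- Both γ and β lie on the hyperbola, so q = (1 - γ)(1 - β) governs the bound again, up to a
perturbation in x, the excess of τ over 2/5. -/
theorem ratio_small_offer_early {γ β x k : ℝ} (hγ : 0 ≤ γ) (hγ1 : γ ≤ 1) (hβ : 0 ≤ β) (hx : 0 ≤ x) (hx1 : x ≤ 3 / 5) (hk : 0 ≤ k) (hkx : k ≤ 57 / 100 * x) (hβ2 : β < 2 / 5) (hγ2 : γ < 2 / 5) :
    569 / 1000 ≤ 8 / 100 * γ + gainPrimitive γ + gainPrimitive β
      + (1 - γ) * (92 / 100 + k - (1 - (2 / 5 + x) + β) * (297 / 1000 + 57 / 100 * (2 / 5 + x)))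
      + (16 / 1000 - 8 / 10 * k + 5 * k ^ 2) := by
  have hlog : -(63 / 200) * Real.log ((1 - γ) * (1 - β))
      ≤ gainPrimitive γ + gainPrimitive β := by
    rw [Real.log_mul (by linarith) (by linarith)]
    rw [gainPrimitive, if_pos hγ2, gainPrimitive, if_pos hβ2]
    linarith
  set q := (1 - γ) * (1 - β) with hq
  have hq0 : 0 < q := mul_pos (by linarith) (by linarith)
  have hqu : q ≤ 1 - γ := by rw [hq]; nlinarith
  have e : (1 - γ) * (92 / 100 + k - (1 - (2 / 5 + x) + β) *
      (297 / 1000 + 57 / 100 * (2 / 5 + x))) = q * (525 / 1000 + 57 / 100 * x)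
      + 8 / 100 * (1 - γ)
      + (1 - γ) * (k - 387 / 1000 * x + 57 / 100 * x ^ 2) := by rw [hq]; ring
  rw [e]
  have hlow : 160902 / 1000000 + 315 / 1000 - 525 / 1000 * q ≤ -(63 / 200) * Real.log q ∧
      (q ≤ 3 / 5 → 160902 / 1000000 + 315 / 1000 - 525 / 1000 * q
        + 4375 / 10000 * (q - 3 / 5) ^ 2 ≤ -(63 / 200) * Real.log q) := by
    refine ⟨by have := neg_log_lower hq0; linarith, fun h => ?_⟩
    have := neg_log_lower_left hq0 h
    linarith
  -- Since q ≤ 1 - γ ≤ 1, the factor 1 - γ is replaced by q when the perturbation is nonnegative and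
  -- by 1 when it is negative.
  rcases le_or_gt 0 (k - 387 / 1000 * x + 57 / 100 * x ^ 2) with hs | hs
  · have hu : q * (k - 387 / 1000 * x + 57 / 100 * x ^ 2)
        ≤ (1 - γ) * (k - 387 / 1000 * x + 57 / 100 * x ^ 2) := by gcongr
    have hqx : q * (132 / 100 * k) ≤ q * (k + 183 / 1000 * x + 57 / 100 * x ^ 2) := by
      gcongr; nlinarith
    have hsum : q * (132 / 100 * k) ≤ q * (57 / 100 * x)
        + (1 - γ) * (k - 387 / 1000 * x + 57 / 100 * x ^ 2) := by linarith
    clear_value q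
    clear hu hqx hs hqu hq
    generalize (1 - γ) * (k - 387 / 1000 * x + 57 / 100 * x ^ 2) = t at hsum ⊢
    rcases le_or_gt q (3 / 5) with h | h
    · have := hlow.2 h
      have : 0 ≤ 5 * k ^ 2 - 132 / 100 * k * (3 / 5 - q) + 4375 / 10000 * (q - 3 / 5) ^ 2 := by
        nlinarith [sq_nonneg (k - 132 / 1000 * (3 / 5 - q)), sq_nonneg (q - 3 / 5)]
      linarith
    · have := hlow.1
      have := mul_nonneg hk (sub_nonneg.2 h.le)
      have := sq_nonneg k
      linarith
  · have hu : (k - 387 / 1000 * x + 57 / 100 * x ^ 2)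
        ≤ (1 - γ) * (k - 387 / 1000 * x + 57 / 100 * x ^ 2) := by nlinarith
    rcases le_or_gt q (3 / 5) with h | h
    · have := hlow.2 h
      nlinarith [sq_nonneg (x + 15 / 10 * (q - 3 / 5)), sq_nonneg k,
        sq_nonneg (x - 58 / 1000)]
    · have := hlow.1
      nlinarith [mul_nonneg hx (sub_nonneg.2 h.le), sq_nonneg k, sq_nonneg (x - 4 / 100)]

theorem ratio_small_offer_passive {γ β x k : ℝ} (hγ : 0 ≤ γ) (hγ1 : γ ≤ 1) (hβ : 0 ≤ β) (hx : 0 ≤ x) (hk : 0 ≤ k) (hkx : k ≤ 57 / 100 * x) (hγ2 : 2 / 5 ≤ γ) :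
    569 / 1000 ≤ 8 / 100 * γ + gainPrimitive γ + gainPrimitive β
      + (1 - γ) * (92 / 100 + k - (1 - (2 / 5 + x) + β) * (297 / 1000 + 57 / 100 * (2 / 5 + x)))
      + (16 / 1000 - 8 / 10 * k + 5 * k ^ 2) := by
  have h1 := gainPrimitive_of_ge hγ2
  have h2 := gainPrimitive_lower hβ
  obtain ⟨e, rfl⟩ : ∃ e, γ = 2 / 5 + e := ⟨γ - 2 / 5, by ring⟩
  have he : 0 ≤ e := by linarith
  have he1 : e ≤ 3 / 5 := by linarith
  have id : (1 - (2 / 5 + e)) * (92 / 100 + k - (1 - (2 / 5 + x) + β) *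
      (297 / 1000 + 57 / 100 * (2 / 5 + x))) = (3 / 5 - e) * (605 / 1000 + k)
      + (3 / 5 - e) * (183 / 1000 * x + 57 / 100 * x ^ 2 - 57 / 100 * x * β)
      - (315 / 1000 - 525 / 1000 * e) * β := by ring
  rw [id]
  have key : (3 / 5 - e) * (183 / 1000 * x) ≤
      (3 / 5 - e) * (183 / 1000 * x + 57 / 100 * x ^ 2 - 57 / 100 * x * β)
        + 63 / 400 * β ^ 2 := by
    have h0 : 0 ≤ (3 / 5 - e) * (57 / 100 * x ^ 2 - 57 / 100 * x * β + 57 / 400 * β ^ 2) :=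
      mul_nonneg (by linarith) (by nlinarith [sq_nonneg (x - β / 2)])
    nlinarith [mul_nonneg he (sq_nonneg β), sq_nonneg β]
  have hkk : (3 / 5 - e) * (32 / 100 * k) ≤ (3 / 5 - e) * (183 / 1000 * x) :=
    mul_le_mul_of_nonneg_left (by linarith) (by linarith)
  have : 0 ≤ e * β := by positivity
  have := sq_nonneg (e - 2316 / 1000 * k)
  have := sq_nonneg (k - 2 / 1000)
  have := mul_nonneg he hk
  linarith

/-- The case of an alternative offer below 395/1000. Since the offer is at least 92/100 + k minus
the density at τ, its smallness is what bounds k by τ. The subcases record which of β and γ lie on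
the hyperbola. -/
theorem ratio_small_offer {γ β τ k : ℝ} (hγ : 0 ≤ γ) (hγ1 : γ ≤ 1) (hβ : 0 ≤ β) (hβτ : β ≤ τ)
    (hτ : 2 / 5 ≤ τ) (hτ1 : τ ≤ 1) (hk : 0 ≤ k)
    (hkτ : k ≤ 57 / 100 * (τ - 2 / 5)) :
    569 / 1000 ≤ 8 / 100 * γ + gainPrimitive γ + gainPrimitive β
      + (1 - γ) * (92 / 100 + k - (1 - τ + β) * (297 / 1000 + 57 / 100 * τ))
      + (16 / 1000 - 8 / 10 * k + 5 * k ^ 2) := by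
  obtain ⟨x, rfl⟩ : ∃ x, τ = 2 / 5 + x := ⟨τ - 2 / 5, by ring⟩
  have hx : 0 ≤ x := by linarith
  have hx1 : x ≤ 3 / 5 := by linarith
  have hkx : k ≤ 57 / 100 * x := by linarith
  rcases le_or_gt (2 / 5) β with hβ2 | hβ2
  · exact ratio_small_offer_late hγ hγ1 hβ hβτ hk hβ2
  · rcases lt_or_ge γ (2 / 5) with hγ2 | hγ2
    · exact ratio_small_offer_early hγ hγ1 hβ hx hx1 hk hkx hβ2 hγ2
    · exact ratio_small_offer_passive hγ hγ1 hβ hx hk hkx hγ2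

/-- The case τ = 1, where nothing but nonnegativity is known about σ and all terms with σ are
dropped. -/
theorem ratio_no_alternative {γ β k : ℝ} (hγ : 0 ≤ γ) (hγ1 : γ ≤ 1) (hβ : 0 ≤ β) (hβ1 : β ≤ 1)
    (hk : 0 ≤ k) (hk1 : k ≤ 1 / 25) :
    569 / 1000 ≤ 8 / 100 * γ + gainPrimitive γ + gainPrimitive β
      + (1 - γ) * ((1 - β) * (92 / 100 + k)) + (16 / 1000 - 8 / 10 * k + 5 * k ^ 2) := by
  rcases le_or_gt β (2 / 5) with hβ2 | hβ2
  · refine (ratio_small hγ hγ1 hβ hβ2 hk).trans ?_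
    have : (1 - γ) * (605 / 1000 + k - β * (525 / 1000 + k))
        ≤ (1 - γ) * ((1 - β) * (92 / 100 + k)) :=
      mul_le_mul_of_nonneg_left (by nlinarith) (by linarith)
    linarith
  · have h1 := gainPrimitive_lower hγ
    have h2 := gainPrimitive_of_ge hβ2.le
    obtain ⟨w, rfl⟩ : ∃ w, β = 1 - w := ⟨1 - β, by ring⟩
    have hw : 0 ≤ w := by linarith
    have hkw : 0 ≤ (1 - γ) * (w * k) := mul_nonneg (by linarith) (by positivity)
    have hk2 : -(24 / 1000) ≤ -(8 / 10 * k) + 5 * k ^ 2 := by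
      nlinarith [mul_nonneg (sub_nonneg.2 hk1) (by linarith : 0 ≤ 3 / 25 - k)]
    have hq : 0 ≤ 53 / 1000 * w + 285 / 1000 * w ^ 2 + γ * (395 / 1000 - 92 / 100 * w)
        + 63 / 400 * γ ^ 2 := by
      rcases le_or_gt w (42 / 100) with h | h
      · have : 0 ≤ γ * (395 / 1000 - 92 / 100 * w) := mul_nonneg hγ (by linarith)
        positivity
      · nlinarith [sq_nonneg (63 / 200 * γ - (92 / 100 * w - 395 / 1000)),
          mul_nonneg (sub_nonneg.2 h.le) (by linarith : 0 ≤ 3 / 5 - w)]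
    linarith

/-- The factor-revealing inequality. -/
theorem ratio_bound {γ β τ k σ : ℝ} (hγ : 0 ≤ γ) (hγ1 : γ ≤ 1) (hβ : 0 ≤ β) (hβτ : β ≤ τ)
    (hτ1 : τ ≤ 1) (hk : 0 ≤ k) (hk1 : k ≤ 1 / 25) (hσ : 0 ≤ σ)
    (hστ : τ < 1 → 92 / 100 + k - gainSlope τ ≤ σ) :
    569 / 1000 ≤ 8 / 100 * γ + gainPrimitive γ + gainPrimitive β
      + (1 - γ) * ((τ - β) * (92 / 100 + k) + (1 - τ) * σ + β * min (395 / 1000) σ)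
      + (16 / 1000 - 8 / 10 * k + 5 * k ^ 2) := by
  have hγ' : 0 ≤ 1 - γ := by linarith
  rcases hτ1.lt_or_eq with hτ | rfl
  · have hs := hστ hτ
    rw [gainSlope] at hs
    split_ifs at hs with h
    -- The density is at most 525/1000 here, and 920 - 525 = 395.
    · have hm : 395 / 1000 ≤ σ := by
        refine le_trans ?_ hs
        have : 63 / 200 / (1 - τ) ≤ 525 / 1000 := by
          rw [div_le_iff₀ (by linarith)]; linarith
        linarith
      rw [min_eq_left hm]
      refine (ratio_small hγ hγ1 hβ (by linarith) hk).trans ?_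
      -- This is the purpose of the hyperbola: (1 - τ) times the density is constant, so τ
      -- disappears from the bound.
      have h3 : (1 - τ) * (92 / 100 + k) - 63 / 200 ≤ (1 - τ) * σ := by
        have := mul_le_mul_of_nonneg_left hs (by linarith : 0 ≤ 1 - τ)
        rw [mul_sub, mul_div_cancel₀ _ (by linarith : (1 - τ) ≠ 0)] at this
        exact this
      have : (1 - γ) * (605 / 1000 + k - β * (525 / 1000 + k)) ≤
          (1 - γ) * ((τ - β) * (92 / 100 + k) + (1 - τ) * σ + β * (395 / 1000)) :=
        mul_le_mul_of_nonneg_left (by nlinarith) hγ'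
      linarith
    · have hτ2 : 2 / 5 ≤ τ := not_lt.1 h
      have h3 := mul_le_mul_of_nonneg_left hs (by linarith : 0 ≤ 1 - τ)
      rcases le_or_gt (395 / 1000) σ with hm | hm
      · rw [min_eq_left hm]
        rcases le_or_gt β (2 / 5) with hβ2 | hβ2
        · refine (ratio_small hγ hγ1 hβ hβ2 hk).trans ?_
          have : (1 - γ) * (605 / 1000 + k - β * (525 / 1000 + k)) ≤
              (1 - γ) * ((τ - β) * (92 / 100 + k) + (1 - τ) * σ + β * (395 / 1000)) :=
            mul_le_mul_of_nonneg_left (by nlinarith) hγ'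
          linarith
        -- On the linear part (1 - τ) times the density is decreasing in τ, so the worst case is τ =
        -- β.
        · refine (ratio_large_offer hγ hγ1 hβ2.le (by linarith) hk hk1).trans ?_
          have : (1 - γ) * ((1 - β) * (92 / 100 + k - (297 / 1000 + 57 / 100 * β))
              + 395 / 1000 * β) ≤
              (1 - γ) * ((τ - β) * (92 / 100 + k) + (1 - τ) * σ + β * (395 / 1000)) := by
            refine mul_le_mul_of_nonneg_left ?_ hγ'
            nlinarith [mul_nonneg (sub_nonneg.2 hβτ) (by linarith : 0 ≤ τ + β - 8 / 10)]
          linarith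
      · rw [min_eq_right hm.le]
        refine (ratio_small_offer hγ hγ1 hβ hβτ hτ2 hτ.le hk (by linarith)).trans ?_
        have : (1 - γ) * (92 / 100 + k - (1 - τ + β) * (297 / 1000 + 57 / 100 * τ)) ≤
            (1 - γ) * ((τ - β) * (92 / 100 + k) + (1 - τ) * σ + β * σ) := by
          refine mul_le_mul_of_nonneg_left ?_ hγ'
          nlinarith [mul_le_mul_of_nonneg_left hs hβ]
        linarith
  · refine (ratio_no_alternative hγ hγ1 hβ hβτ hk hk1).trans ?_
    have : (1 - γ) * ((1 - β) * (92 / 100 + k)) ≤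
        (1 - γ) * ((1 - β) * (92 / 100 + k) + (1 - 1) * σ + β * min (395 / 1000) σ) := by
      refine mul_le_mul_of_nonneg_left ?_ hγ'
      have : 0 ≤ β * min (395 / 1000) σ := mul_nonneg hβ (le_min (by norm_num) hσ)
      linarith
    linarith

end BalancedRanking

/-! ### The functions `f` and `g`, their primitives and rank thresholds. -/

namespace BalancedRanking

/-- The function `f` of Balanced Ranking. -/
noncomputable def waterWeight (x : ℝ) : ℝ := 1 / 10 * min x (2 / 5)

/-- The function `g` of Balanced Ranking. -/
noncomputable def rankWeight (y : ℝ) : ℝ := gainSlope y + 1 / 25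

/-- The primitive of `waterWeight`. -/
noncomputable def waterPrimitive (x : ℝ) : ℝ :=
  if x ≤ 2 / 5 then x ^ 2 / 20 else x / 25 - 1 / 125

/-- The hyperbola has slope at least 63/200, the line has slope 57/100, and both pieces take the
value 525/1000 at 2/5. This yields strict monotonicity and, with room to spare, the 1/100 reverse
Lipschitz bound. -/
theorem gainSlope_slope {a b : ℝ} (hb : 0 ≤ b) (hba : b ≤ a) :
    63 / 200 * (a - b) ≤ gainSlope a - gainSlope b := by
  have early : ∀ {b c : ℝ}, 0 ≤ b → b ≤ c → c < 1 →
      63 / 200 * (c - b) ≤ 63 / 200 / (1 - c) - 63 / 200 / (1 - b) := by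
    intro b c hb hbc hc
    have h1 : 0 < 1 - c := by linarith
    have h2 : 0 < 1 - b := by linarith
    have : 63 / 200 / (1 - c) - 63 / 200 / (1 - b) = 63 / 200 * (c - b) / ((1 - c) * (1 - b)) := by
      field_simp; ring
    rw [this, le_div_iff₀ (by positivity)]
    have h3 : (1 - c) * (1 - b) ≤ 1 := by nlinarith
    have h4 : 0 ≤ 63 / 200 * (c - b) := by linarith
    nlinarith
  unfold gainSlope
  split_ifs with h1 h2 h2
  · exact early hb hba (by linarith)
  · linarith
  · have := early (c := 2 / 5) hb h2.le (by norm_num)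
    norm_num at this h1 ⊢
    linarith
  · linarith

theorem gainSlope_strictMonoOn : StrictMonoOn gainSlope (Set.Ici 0) := by
  intro b hb a _ hba
  have := gainSlope_slope (Set.mem_Ici.1 hb) hba.le
  nlinarith

theorem gainSlope_lower {y : ℝ} (hy : 0 ≤ y) : 63 / 200 ≤ gainSlope y := by
  have := gainSlope_slope le_rfl hy
  have h0 : gainSlope 0 = 63 / 200 := by norm_num [gainSlope]
  nlinarith

theorem gainSlope_upper {y : ℝ} (hy : 0 ≤ y) (hy1 : y ≤ 1) : gainSlope y ≤ 867 / 1000 := by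
  have := gainSlope_slope hy hy1
  have h0 : gainSlope 1 = 867 / 1000 := by norm_num [gainSlope]
  nlinarith

theorem measurable_gainSlope : Measurable gainSlope := by
  unfold gainSlope
  exact Measurable.ite measurableSet_Iio (by fun_prop) (by fun_prop)

theorem measurable_rankWeight : Measurable rankWeight := measurable_gainSlope.add_const _

theorem rankWeight_strictMonoOn : StrictMonoOn rankWeight (Set.Ici 0) := fun _ ha _ hb h =>
  add_lt_add_left (gainSlope_strictMonoOn ha hb h) _

theorem waterWeight_mono : Monotone waterWeight := fun a b h => by
  unfold waterWeight
  gcongr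

theorem continuous_waterWeight : Continuous waterWeight := by
  unfold waterWeight
  fun_prop

theorem waterWeight_nonneg {x : ℝ} (hx : 0 ≤ x) : 0 ≤ waterWeight x := by
  unfold waterWeight
  positivity

theorem waterWeight_le (x : ℝ) : waterWeight x ≤ 1 / 25 := by
  unfold waterWeight
  have := min_le_right x (2 / 5)
  linarith

theorem admissible : Admissible waterWeight rankWeight where
  f_mapsTo x hx := ⟨waterWeight_nonneg hx.1, (waterWeight_le x).trans (by norm_num)⟩
  g_mapsTo y hy := by
    have h1 := gainSlope_lower hy.1
    have h2 := gainSlope_upper hy.1 hy.2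
    exact ⟨by unfold rankWeight; linarith, by unfold rankWeight; linarith⟩
  f_mono := waterWeight_mono.monotoneOn _
  f_lipschitz a _ b _ hba := by
    unfold waterWeight
    rcases le_total a (2 / 5) with h | h <;> rcases le_total b (2 / 5) with h' | h' <;>
      simp only [min_eq_left, min_eq_right, h, h'] <;> linarith
  g_reverseLipschitz a _ b hb hba := by
    have := gainSlope_slope hb.1 hba
    unfold rankWeight
    linarith
  boundary := by
    have h2 := gainSlope_upper zero_le_one le_rfl
    have h3 := waterWeight_le 1
    unfold rankWeight
    linarith

/-- A right-endpoint Riemann sum of a nondecreasing function dominates its integral. The lookahead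
level is the right endpoint, which is why the level after the deadline is used in the offers. -/
theorem waterPrimitive_step {w x : ℝ} (hwx : w ≤ x) :
    waterPrimitive x - waterPrimitive w ≤ (x - w) * waterWeight x := by
  unfold waterPrimitive waterWeight
  rcases le_or_gt x (2 / 5) with h | h
  · rw [if_pos h, if_pos (hwx.trans h), min_eq_left h]
    nlinarith [sq_nonneg (x - w)]
  · rw [if_neg (not_le.2 h), min_eq_right h.le]
    split_ifs with h'
    · nlinarith [sq_nonneg (w - 2 / 5)]
    · linarith

/-- The primitive is convex and coincides with its tangent at 2/5 from there on. A linear bound in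
the level of `u` becomes a bonus of 1/25 on the event that `u` is matched. -/
theorem waterPrimitive_tangent (x : ℝ) : x / 25 - 1 / 125 ≤ waterPrimitive x := by
  unfold waterPrimitive
  split_ifs
  · nlinarith [sq_nonneg (x - 2 / 5)]
  · exact le_rfl

/-- This eliminates the level in favour of k = 1/25 - f(x), the amount by which the water discount
falls short of its maximum. It is an equality up to level 2/5, where x = 2/5 - 10 k. -/
theorem waterPrimitive_add_lower (x : ℝ) :
    16 / 1000 - 8 / 10 * (1 / 25 - waterWeight x) + 5 * (1 / 25 - waterWeight x) ^ 2
      ≤ waterPrimitive x + x / 25 - 1 / 125 := by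
  unfold waterPrimitive waterWeight
  split_ifs with h
  · rw [min_eq_left h]
    nlinarith
  · rw [min_eq_right (not_le.1 h).le]
    linarith

theorem gainPrimitive_eq (y : ℝ) : gainPrimitive y =
    -(63 / 200) * Real.log (1 - min y (2 / 5)) + 525 / 1000 * max (y - 2 / 5) 0
      + 285 / 1000 * max (y - 2 / 5) 0 ^ 2 := by
  unfold gainPrimitive
  split_ifs with h
  · rw [min_eq_left h.le, max_eq_right (by linarith)]
    ring
  · rw [min_eq_right (not_lt.1 h), max_eq_left (by linarith)]
    norm_num

theorem continuous_gainPrimitive : Continuous gainPrimitive := by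
  have : gainPrimitive = fun y => -(63 / 200) * Real.log (1 - min y (2 / 5))
      + 525 / 1000 * max (y - 2 / 5) 0 + 285 / 1000 * max (y - 2 / 5) 0 ^ 2 :=
    funext gainPrimitive_eq
  rw [this]
  have h : Continuous fun y : ℝ => Real.log (1 - min y (2 / 5)) := by
    refine Continuous.log (by fun_prop) fun y => ?_
    have := min_le_right y (2 / 5 : ℝ)
    linarith
  fun_prop

theorem hasDerivWithinAt_gainPrimitive (y : ℝ) :
    HasDerivWithinAt gainPrimitive (gainSlope y) (Set.Ioi y) y := by
  rcases lt_or_ge y (2 / 5) with h | h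
  · have hd : HasDerivAt (fun y : ℝ => -(63 / 200) * Real.log (1 - y)) (gainSlope y) y := by
      have h1 : (1 : ℝ) - y ≠ 0 := by linarith
      have := (((hasDerivAt_id y).const_sub 1).log h1).const_mul (-(63 / 200))
      refine this.congr_deriv ?_
      rw [gainSlope, if_pos h]
      simp only [id]
      ring
    refine (hd.congr_of_eventuallyEq ?_).hasDerivWithinAt
    filter_upwards [Iio_mem_nhds h] with z hz
    rw [gainPrimitive, if_pos (Set.mem_Iio.1 hz)]
  · have hd : HasDerivAt (fun y : ℝ => -(63 / 200) * Real.log (3 / 5) + 525 / 1000 * (y - 2 / 5)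
        + 285 / 1000 * (y - 2 / 5) ^ 2) (gainSlope y) y := by
      have e := (hasDerivAt_id y).sub_const (2 / 5)
      have := ((e.const_mul (525 / 1000)).const_add (-(63 / 200) * Real.log (3 / 5))).add
        ((e.pow 2).const_mul (285 / 1000))
      refine this.congr_deriv ?_
      rw [gainSlope, if_neg (not_lt.2 h)]
      simp only [id]
      norm_num
      ring
    refine hd.hasDerivWithinAt.congr (fun z hz => ?_) ?_
    · rw [gainPrimitive, if_neg (not_lt.2 (h.trans (le_of_lt hz)))]
    · rw [gainPrimitive, if_neg (not_lt.2 h)]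

theorem integral_gainSlope {c : ℝ} (hc : 0 ≤ c) :
    ∫ s in (0 : ℝ)..c, gainSlope s = gainPrimitive c := by
  rw [intervalIntegral.integral_eq_sub_of_hasDeriv_right continuous_gainPrimitive.continuousOn
    (fun x _ => hasDerivWithinAt_gainPrimitive x)]
  · have : gainPrimitive 0 = 0 := by norm_num [gainPrimitive]
    rw [this, sub_zero]
  · refine MonotoneOn.intervalIntegrable (gainSlope_strictMonoOn.monotoneOn.mono ?_)
    rw [Set.uIcc_of_le hc]
    exact Set.Icc_subset_Ici_self

theorem continuousWithinAt_gainSlope (y : ℝ) : ContinuousWithinAt gainSlope (Set.Ioi y) y := by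
  rcases lt_or_ge y (2 / 5) with h | h
  · have : ContinuousAt (fun y : ℝ => 63 / 200 / (1 - y)) y :=
      ContinuousAt.div (by fun_prop) (by fun_prop) (by linarith)
    refine (this.congr ?_).continuousWithinAt
    filter_upwards [Iio_mem_nhds h] with z hz
    rw [gainSlope, if_pos (Set.mem_Iio.1 hz)]
  · have : ContinuousAt (fun y : ℝ => 297 / 1000 + 57 / 100 * y) y := by fun_prop
    refine this.continuousWithinAt.congr (fun z hz => ?_) ?_
    · rw [gainSlope, if_neg (not_lt.2 (h.trans (le_of_lt hz)))]
    · rw [gainSlope, if_neg (not_lt.2 h)]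

/-- The uniform distribution on `[0, 1]`. -/
noncomputable abbrev uniform : Measure ℝ := volume.restrict (Set.Icc (0 : ℝ) 1)

instance : IsProbabilityMeasure uniform :=
  ⟨by rw [Measure.restrict_apply MeasurableSet.univ]; simp⟩

theorem ae_uniform_mem : ∀ᵐ s ∂uniform, s ∈ Set.Icc (0 : ℝ) 1 :=
  ae_restrict_mem measurableSet_Icc

theorem integral_indicator_Ico {a b : ℝ} (ha : 0 ≤ a) (hab : a ≤ b) (hb : b ≤ 1) (h : ℝ → ℝ) :
    ∫ s, (Set.Ico a b).indicator h s ∂uniform = ∫ s in a..b, h s := by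
  rw [integral_indicator measurableSet_Ico, Measure.restrict_restrict measurableSet_Ico,
    Set.inter_eq_left.2 (Set.Ico_subset_Icc_self.trans (Set.Icc_subset_Icc ha hb)),
    intervalIntegral.integral_of_le hab]
  exact setIntegral_congr_set Ico_ae_eq_Ioc

theorem exists_threshold {P : ℝ → Prop}
    (hP : ∀ s ∈ Set.Icc (0 : ℝ) 1, ∀ s' ∈ Set.Icc (0 : ℝ) 1, s ≤ s' → P s' → P s) :
    ∃ c ∈ Set.Icc (0 : ℝ) 1, ∀ s ∈ Set.Icc (0 : ℝ) 1, (s < c → P s) ∧ (c < s → ¬ P s) := by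
  -- Inserting 0 keeps the supremum meaningful when the property never holds in the interval. At the
  -- threshold itself nothing is claimed; it is a null set.
  set A : Set ℝ := insert 0 {s | s ∈ Set.Icc (0 : ℝ) 1 ∧ P s} with hA
  have hne : A.Nonempty := ⟨0, by simp [hA]⟩
  have hb : ∀ s ∈ A, s ≤ 1 := by
    rintro s (rfl | h)
    · exact zero_le_one
    · exact h.1.2
  refine ⟨sSup A, ⟨le_csSup ⟨1, hb⟩ (by simp [hA]), csSup_le hne hb⟩, fun s hs => ⟨fun h => ?_,
    fun h hPs => ?_⟩⟩
  · obtain ⟨t, ht, hst⟩ := exists_lt_of_lt_csSup hne h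
    rcases ht with rfl | ht
    · exact absurd hs.1 (not_le.2 hst)
    · exact hP s hs t ht.1 hst.le ht.2
  · exact absurd (le_csSup ⟨1, hb⟩ (show s ∈ A from Or.inr ⟨hs, hPs⟩)) (not_le.2 h)

end BalancedRanking

/-! ### Averaging over the two ranks of an edge. -/

namespace BalancedRanking

theorem integrable_indicator_Ico {a b : ℝ} {h : ℝ → ℝ} (hm : Measurable h) {M : ℝ}
    (hM : ∀ s ∈ Set.Icc (0 : ℝ) 1, |h s| ≤ M) :
    Integrable ((Set.Ico a b).indicator h) uniform := by
  refine Integrable.of_bound (hm.indicator measurableSet_Ico).aestronglyMeasurable M ?_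
  filter_upwards [ae_uniform_mem] with s hs
  refine le_trans ?_ (hM s hs)
  rw [Real.norm_eq_abs]
  by_cases h1 : s ∈ Set.Ico a b
  · rw [Set.indicator_of_mem h1]
  · rw [Set.indicator_of_notMem h1, abs_zero]
    exact abs_nonneg _

theorem integral_indicator_const_Ico {a b : ℝ} (ha : 0 ≤ a) (hab : a ≤ b) (hb : b ≤ 1) (c : ℝ) :
    ∫ s, (Set.Ico a b).indicator (fun _ => c) s ∂uniform = (b - a) * c := by
  rw [integral_indicator_Ico ha hab hb, intervalIntegral.integral_const, smul_eq_mul]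

theorem intervalIntegrable_gainSlope {c : ℝ} (hc : 0 ≤ c) :
    IntervalIntegrable gainSlope volume 0 c := by
  refine MonotoneOn.intervalIntegrable (gainSlope_strictMonoOn.monotoneOn.mono ?_)
  rw [Set.uIcc_of_le hc]
  exact Set.Icc_subset_Ici_self

theorem ae_prod_generic (γ β τ : ℝ) : ∀ᵐ p ∂uniform.prod uniform,
    p.1 ∈ Set.Icc (0 : ℝ) 1 ∧ p.2 ∈ Set.Icc (0 : ℝ) 1 ∧ p.1 ≠ γ ∧ p.2 ≠ β ∧ p.2 ≠ τ := by
  have h1 : ∀ c : ℝ, ∀ᵐ s ∂uniform, s ∈ Set.Icc (0 : ℝ) 1 ∧ s ≠ c := fun c => by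
    filter_upwards [ae_uniform_mem, (Measure.ae_ne (volume.restrict (Set.Icc (0 : ℝ) 1)) c)] with s hs hc
    exact ⟨hs, hc⟩
  filter_upwards [Measure.quasiMeasurePreserving_fst.ae (h1 γ),
    Measure.quasiMeasurePreserving_snd.ae (h1 β),
    Measure.quasiMeasurePreserving_snd.ae (h1 τ)] with p h1 h2 h3
  exact ⟨h1.1, h2.1, h1.2, h2.2, h3.2⟩

/-- The gain of a pair of neighbours `u`, `v`, averaged over their two ranks `s` and `t`: `P` says
that `u` is matched before its deadline, `Q` that `v` is, `R` that `v` outbids the alternatives of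
`u` at `u`'s deadline, and `σ` is the best alternative offer. -/
theorem pair_bound {Ψ : ℝ × ℝ → ℝ} {b σ : ℝ} {P Q R : ℝ → Prop} (hb : 0 ≤ b)
    (hP : ∀ s ∈ Set.Icc (0 : ℝ) 1, ∀ s' ∈ Set.Icc (0 : ℝ) 1, s ≤ s' → P s' → P s)
    (hQ : ∀ s ∈ Set.Icc (0 : ℝ) 1, ∀ s' ∈ Set.Icc (0 : ℝ) 1, s ≤ s' → Q s' → Q s)
    (hR : ∀ s ∈ Set.Icc (0 : ℝ) 1, ∀ s' ∈ Set.Icc (0 : ℝ) 1, s ≤ s' → R s' → R s)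
    (hσ : 0 ≤ σ) (hRσ : ∀ t ∈ Set.Icc (0 : ℝ) 1, ¬ R t → 1 - rankWeight t - waterWeight b ≤ σ)
    (hΨ : Integrable Ψ (uniform.prod uniform))
    (hlow : ∀ᵐ p ∂uniform.prod uniform,
      (P p.1 → rankWeight p.1 + 1 / 25 ≤ Ψ p) ∧
      (P p.1 → Q p.2 → rankWeight p.1 + 1 / 25 + (rankWeight p.2 - 1 / 25) ≤ Ψ p) ∧
      (¬ P p.1 → Q p.2 → rankWeight p.2 - 1 / 25 + min (rankWeight p.1 + 1 / 25) σ ≤ Ψ p) ∧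
      (¬ P p.1 → ¬ Q p.2 → R p.2 → 1 - waterWeight b - 1 / 25 ≤ Ψ p) ∧
      (¬ P p.1 → ¬ Q p.2 → ¬ R p.2 → σ ≤ Ψ p)) :
    569 / 1000 ≤ (∫ p, Ψ p ∂uniform.prod uniform) + (waterPrimitive b + b / 25 - 1 / 125) := by
  obtain ⟨γ, hγ, hPγ⟩ := exists_threshold hP
  obtain ⟨β, hβ, hQβ⟩ := exists_threshold hQ
  obtain ⟨τ₀, hτ₀, hRτ⟩ := exists_threshold hR
  -- For t < β the bounds used do not look at `R`, so its threshold may be raised to β.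
  set τ := max τ₀ β with hτ
  have hβτ : β ≤ τ := le_max_right _ _
  have hτ1 : τ ≤ 1 := max_le hτ₀.2 hβ.2
  set k := 1 / 25 - waterWeight b with hk
  -- Here 395/1000 = 63/200 + 2/25 bounds `rankWeight s + 1/25` from below for all s. Making the
  -- minimum independent of s lets the lower bound factor into a function of s times a function of
  -- t.
  set m := min (395 / 1000) σ with hm
  have hk0 : 0 ≤ k := by have := waterWeight_le b; rw [hk]; linarith
  have hk1 : k ≤ 1 / 25 := by have := waterWeight_nonneg hb; rw [hk]; linarith
  have hm0 : 0 ≤ m := le_min (by norm_num) hσ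
  -- Just above τ the vertex `v` fails to beat the alternatives, so σ is at least its offer there;
  -- then t decreases to τ by right continuity of the density.
  have hστ : τ < 1 → 92 / 100 + k - gainSlope τ ≤ σ := by
    intro h
    have ht : Filter.Tendsto (fun t => 92 / 100 + k - gainSlope t) (nhdsWithin τ (Set.Ioi τ))
        (nhds (92 / 100 + k - gainSlope τ)) :=
      (continuousWithinAt_gainSlope τ).tendsto.const_sub _
    refine le_of_tendsto ht ?_
    filter_upwards [Ioo_mem_nhdsGT h] with t ht
    have ht' : t ∈ Set.Icc (0 : ℝ) 1 := ⟨(hβ.1.trans hβτ).trans ht.1.le, ht.2.le⟩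
    have := hRσ t ht' ((hRτ t ht').2 ((le_max_left _ _).trans_lt ht.1))
    unfold rankWeight at this
    rw [hk]
    linarith
  have key := ratio_bound hγ.1 hγ.2 hβ.1 hβτ hτ1 hk0 hk1 hσ hστ
  have hw := waterPrimitive_add_lower b
  rw [← hk] at hw
  -- the lower bound as a sum of products
  set A : ℝ → ℝ := (Set.Ico 0 γ).indicator fun s => gainSlope s + 8 / 100 with hA
  set B : ℝ → ℝ := (Set.Ico 0 β).indicator gainSlope with hB
  set C : ℝ → ℝ := (Set.Ico γ 1).indicator fun _ => 1 with hC
  set D : ℝ → ℝ := fun t => (Set.Ico 0 β).indicator (fun _ => m) t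
    + (Set.Ico β τ).indicator (fun _ => 92 / 100 + k) t
    + (Set.Ico τ 1).indicator (fun _ => σ) t with hD
  have habs : ∀ s ∈ Set.Icc (0 : ℝ) 1, |gainSlope s| ≤ 1 := fun s hs => by
    rw [abs_of_nonneg] <;> linarith [gainSlope_lower hs.1, gainSlope_upper hs.1 hs.2]
  have iA : Integrable A uniform := integrable_indicator_Ico (by
    exact measurable_gainSlope.add_const _) (M := 2) fun s hs => by
      rw [abs_of_nonneg] <;> linarith [gainSlope_lower hs.1, gainSlope_upper hs.1 hs.2]
  have iB : Integrable B uniform := integrable_indicator_Ico measurable_gainSlope habs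
  have iconst : ∀ a b c : ℝ, Integrable ((Set.Ico a b).indicator fun _ => c) uniform :=
    fun a b c => integrable_indicator_Ico measurable_const fun _ _ => le_rfl
  have iC : Integrable C uniform := iconst _ _ _
  have iD : Integrable D uniform := ((iconst _ _ _).add (iconst _ _ _)).add (iconst _ _ _)
  have eA : ∫ s, A s ∂uniform = gainPrimitive γ + 8 / 100 * γ := by
    rw [hA, integral_indicator_Ico le_rfl hγ.1 hγ.2, intervalIntegral.integral_add
      (intervalIntegrable_gainSlope hγ.1) intervalIntegrable_const, integral_gainSlope hγ.1]
    simp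
    ring
  have eB : ∫ s, B s ∂uniform = gainPrimitive β := by
    rw [hB, integral_indicator_Ico le_rfl hβ.1 hβ.2, integral_gainSlope hβ.1]
  have eC : ∫ s, C s ∂uniform = 1 - γ := by
    rw [hC, integral_indicator_const_Ico hγ.1 hγ.2 le_rfl, mul_one]
  have eD : ∫ s, D s ∂uniform = (τ - β) * (92 / 100 + k) + (1 - τ) * σ + β * m := by
    have i12 : Integrable (fun t => (Set.Ico 0 β).indicator (fun _ => m) t
        + (Set.Ico β τ).indicator (fun _ => 92 / 100 + k) t) uniform :=
      (iconst 0 β m).add (iconst β τ (92 / 100 + k))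
    rw [hD, integral_add i12 (iconst τ 1 σ), integral_add (iconst 0 β m) (iconst β τ _), integral_indicator_const_Ico le_rfl hβ.1 hβ.2,
      integral_indicator_const_Ico hβ.1 hβτ hτ1,
      integral_indicator_const_Ico (hβ.1.trans hβτ) hτ1 le_rfl]
    ring
  have iAB : Integrable (fun p : ℝ × ℝ => A p.1 + B p.2) (uniform.prod uniform) :=
    (iA.comp_fst uniform).add (iB.comp_snd uniform)
  have iCD : Integrable (fun p : ℝ × ℝ => C p.1 * D p.2) (uniform.prod uniform) := iC.mul_prod iD
  have eL : ∫ p, (A p.1 + B p.2 + C p.1 * D p.2) ∂uniform.prod uniform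
      = gainPrimitive γ + 8 / 100 * γ + gainPrimitive β
        + (1 - γ) * ((τ - β) * (92 / 100 + k) + (1 - τ) * σ + β * m) := by
    rw [integral_add iAB iCD, integral_add (iA.comp_fst uniform) (iB.comp_snd uniform),
      integral_prod_mul, integral_fun_fst, integral_fun_snd, eA, eB, eC, eD]
    simp
  have hle : ∫ p, (A p.1 + B p.2 + C p.1 * D p.2) ∂uniform.prod uniform
      ≤ ∫ p, Ψ p ∂uniform.prod uniform := by
    refine integral_mono_ae (iAB.add iCD) hΨ ?_
    -- The indicators are of half-open intervals, so the null event of a rank equal to 1 has to be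
    -- excluded.
    have hone : ∀ᵐ p ∂uniform.prod uniform, p.1 ≠ (1 : ℝ) ∧ p.2 ≠ (1 : ℝ) := by
      filter_upwards [ae_prod_generic 1 1 1] with p hp
      exact ⟨hp.2.2.1, hp.2.2.2.1⟩
    filter_upwards [ae_prod_generic γ β τ, hlow, hone] with p hp hl h1
    obtain ⟨⟨hs0, hs1⟩, ⟨ht0, ht1⟩, hsγ, htβ, htτ⟩ := hp
    have hPs := hPγ p.1 ⟨hs0, hs1⟩
    have hQt := hQβ p.2 ⟨ht0, ht1⟩
    have hRt := hRτ p.2 ⟨ht0, ht1⟩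
    have hg := gainSlope_lower hs0
    have ht1' := lt_of_le_of_ne ht1 h1.2
    have hs1' := lt_of_le_of_ne hs1 h1.1
    obtain ⟨l1, l2, l3, l4, l5⟩ := hl
    unfold rankWeight at l1 l2 l3
    simp only [hA, hB, hC, hD, Set.indicator_apply, Set.mem_Ico]
    rcases lt_or_gt_of_ne hsγ with hs | hs
    · have hPp := hPs.1 hs
      rcases lt_or_gt_of_ne htβ with ht | ht
      · have := l2 hPp (hQt.1 ht)
        simp only [hs0, hs, not_le.2 hs, ht0, ht, true_and, false_and, if_true, if_false]
        linarith
      · have := l1 hPp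
        simp only [hs0, hs, not_le.2 hs, not_lt.2 ht.le, true_and, false_and, and_false,
          if_true, if_false]
        linarith
    · have hPp := hPs.2 hs
      rcases lt_or_gt_of_ne htβ with ht | ht
      · have := l3 hPp (hQt.1 ht)
        have hmm : m ≤ min (gainSlope p.1 + 1 / 25 + 1 / 25) σ :=
          min_le_min_right _ (by linarith)
        have htτ' : ¬ τ ≤ p.2 := not_le.2 (ht.trans_le hβτ)
        simp only [hs0, hs.le, not_lt.2 hs.le, hs1', ht0, ht, not_le.2 ht, htτ', false_and, and_false,
           and_true, if_true, if_false]
        linarith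
      · have hQp := hQt.2 ht
        rcases lt_or_gt_of_ne htτ with h | h
        · have := l4 hPp hQp (hRt.1 (by
            rcases lt_max_iff.1 h with h' | h'
            · exact h'
            · exact absurd ht (not_lt.2 h'.le)))
          simp only [hs0, hs.le, not_lt.2 hs.le, hs1', ht.le, not_lt.2 ht.le, h, not_le.2 h,
            false_and, and_false, and_true, if_true, if_false]
          linarith
        · have := l5 hPp hQp (hRt.2 ((le_max_left _ _).trans_lt h))
          simp only [hs0, hs.le, not_lt.2 hs.le, hs1', ht1', not_lt.2 ht.le, h.le, not_lt.2 h.le,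
            and_false, and_true, if_true, if_false]
          linarith
  rw [eL] at hle
  rw [← hm] at key
  linarith

end BalancedRanking

/-! ### Chronology of events and induction along prefixes. -/

namespace FullyOnlineInstance

variable {V : Type*} (I : FullyOnlineInstance V)

/-- The element `b` occurs only once, so an occurrence of `a` that precedes some `b` precedes this
one. -/
theorem mem_of_sublist_of_prefix {α : Type*} {l p : List α} {a b : α} (hl : l.Nodup)
    (hab : [a, b].Sublist l) (hp : p ++ [b] <+: l) : a ∈ p := by
  obtain ⟨r, rfl⟩ := hp
  rw [List.append_assoc, List.singleton_append] at hl hab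
  have hbr : b ∉ r := ((List.nodup_append.1 hl).2.1.notMem)
  obtain ⟨l₁, l₂, h, h₁, h₂⟩ := List.sublist_append_iff.1 hab
  match l₁, h with
  | [], h =>
    rw [List.nil_append] at h
    subst h
    cases h₂ with
    | cons _ h => exact absurd (h.subset (by simp)) hbr
    | cons_cons _ h => exact absurd (h.subset (by simp)) hbr
  | c :: l₁, h =>
    rw [List.cons_append, List.cons.injEq] at h
    exact h.1 ▸ h₁.subset (by simp)

variable {I} {p : List (OnlineEvent V)}

theorem notMem_of_prefix {e : OnlineEvent V} (hp : p ++ [e] <+: I.events) : e ∉ p := by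
  have := hp.sublist.nodup I.nodup
  rw [List.nodup_append] at this
  exact fun h => this.2.2 e h e (by simp) rfl

theorem arrival_mem_of_prefix {u : V} (hp : p ++ [.deadline u] <+: I.events) :
    OnlineEvent.arrival u ∈ p :=
  mem_of_sublist_of_prefix I.nodup (I.arrival_before_deadline u) hp

theorem arrival_mem_of_adj {u v : V} (hp : p ++ [.deadline u] <+: I.events)
    (h : I.graph.Adj u v) : OnlineEvent.arrival v ∈ p :=
  mem_of_sublist_of_prefix I.nodup (I.neighbor_before_deadline u v h) hp

theorem prefix_of_append {e : OnlineEvent V} (hp : p ++ [e] <+: I.events) : p <+: I.events :=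
  (List.prefix_append p [e]).trans hp

theorem arrival_mem_of_deadline_mem {u : V} (hp : p <+: I.events)
    (h : OnlineEvent.deadline u ∈ p) : OnlineEvent.arrival u ∈ p := by
  obtain ⟨q, r, rfl⟩ := List.append_of_mem h
  have hq : q ++ [OnlineEvent.deadline u] <+: I.events :=
    List.IsPrefix.trans ⟨r, by simp⟩ hp
  exact List.mem_append_left _ (arrival_mem_of_prefix hq)

/-- Induction along the prefixes of the list of events. -/
theorem prefix_induction {motive : List (OnlineEvent V) → Prop} (nil : motive [])
    (append : ∀ p e, p ++ [e] <+: I.events → motive p → motive (p ++ [e])) :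
    ∀ p, p <+: I.events → motive p := by
  intro p
  induction p using List.reverseRecOn with
  | nil => exact fun _ => nil
  | append_singleton p e ih => exact fun h => append p e h (ih (prefix_of_append h))

end FullyOnlineInstance

/-! ### Dynamics of the available vertices, with vertices deleted: alternating paths and outbidding.
-/

namespace BalancedRanking

open FullyOnlineInstance

variable {V : Type*}

open Classical in
/-- An element of `A` with the largest offer. -/
noncomputable def bestOf (o : V → ℝ) (A : Finset V) : Option V :=
  if h : (A.filter fun v => ∀ w ∈ A, o w ≤ o v).Nonempty then some h.choose else none

theorem bestOf_spec {o : V → ℝ} {A : Finset V} {b : V} (h : bestOf o A = some b) :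
    b ∈ A ∧ ∀ w ∈ A, o w ≤ o b := by
  classical
  unfold bestOf at h
  split_ifs at h with hA
  have := hA.choose_spec
  rw [Option.some.inj h, Finset.mem_filter] at this
  exact this

theorem bestOf_eq_none {o : V → ℝ} {A : Finset V} : bestOf o A = none ↔ A = ∅ := by
  classical
  unfold bestOf
  split_ifs with hA
  · simp only [false_iff]
    rintro rfl
    simp at hA
  · simp only [true_iff]
    by_contra hne
    obtain ⟨b, hb, hmax⟩ := A.exists_max_image o (Finset.nonempty_iff_ne_empty.2 hne)
    exact hA ⟨b, Finset.mem_filter.2 ⟨hb, hmax⟩⟩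

theorem bestOf_eq_some {o : V → ℝ} (ho : Function.Injective o) {A : Finset V} {b : V}
    (hb : b ∈ A) (hmax : ∀ w ∈ A, o w ≤ o b) : bestOf o A = some b := by
  rcases h : bestOf o A with _ | c
  · rw [bestOf_eq_none] at h
    simp [h] at hb
  · have := bestOf_spec h
    exact congrArg some (ho (le_antisymm (hmax c this.1) (this.2 b hb)))

open Classical in
/-- One step of the dynamics of the set of available vertices, with offers `o u v` of `v` at the
deadline of `u`, when the vertices in `K` never arrive. -/
noncomputable def freeStep (G : SimpleGraph V) (o : V → V → ℝ) (K : Set V) (F : Finset V) :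
    OnlineEvent V → Finset V
  | .arrival a => if a ∈ K then F else insert a F
  | .deadline u =>
    if u ∈ F then (F.erase u).filter fun w => bestOf (o u) (F.filter (G.Adj u)) ≠ some w else F

/-- The available vertices after a list of events, when the vertices in `K` never arrive. -/
noncomputable def freeRun (G : SimpleGraph V) (o : V → V → ℝ) (K : Set V)
    (l : List (OnlineEvent V)) : Finset V :=
  l.foldl (freeStep G o K) ∅

variable {G : SimpleGraph V} {o : V → V → ℝ} {K : Set V}

theorem freeRun_append (l : List (OnlineEvent V)) (e : OnlineEvent V) :
    freeRun G o K (l ++ [e]) = freeStep G o K (freeRun G o K l) e := by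
  simp [freeRun]

theorem mem_freeRun {l : List (OnlineEvent V)} {a : V} (h : a ∈ freeRun G o K l) :
    a ∉ K ∧ OnlineEvent.arrival a ∈ l := by
  classical
  induction l using List.reverseRecOn with
  | nil => simp [freeRun] at h
  | append_singleton l e ih =>
    rw [freeRun_append] at h
    rcases e with b | u
    · unfold freeStep at h
      simp only at h
      split_ifs at h with hb
      · exact ⟨(ih h).1, List.mem_append_left _ (ih h).2⟩
      · rcases Finset.mem_insert.1 h with rfl | h
        · exact ⟨hb, by simp⟩
        · exact ⟨(ih h).1, List.mem_append_left _ (ih h).2⟩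
    · have : a ∈ freeRun G o K l := by
        unfold freeStep at h
        simp only at h
        split_ifs at h with hb
        · exact Finset.mem_of_mem_erase (Finset.mem_of_mem_filter _ h)
        · exact h
      exact ⟨(ih this).1, List.mem_append_left _ (ih this).2⟩

/-- `F` has at most one vertex more than `F'`, and this vertex is coloured `c`. -/
def ExtraAtMost (col : V → Bool) (c : Bool) (F F' : Finset V) : Prop :=
  F = F' ∨ ∃ z, z ∉ F' ∧ col z = c ∧ ∀ w, w ∈ F ↔ w = z ∨ w ∈ F'

theorem freeStep_arrival_mem {F : Finset V} {a w : V} (ha : a ∉ K) :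
    w ∈ freeStep G o K F (.arrival a) ↔ w = a ∨ w ∈ F := by
  classical
  unfold freeStep
  simp only [if_neg ha, Finset.mem_insert]

theorem freeStep_arrival_of_mem {F : Finset V} {a : V} (ha : a ∈ K) :
    freeStep G o K F (.arrival a) = F := by
  classical
  unfold freeStep
  simp only [if_pos ha]

theorem freeStep_deadline_of_notMem {F : Finset V} {u : V} (hu : u ∉ F) :
    freeStep G o K F (.deadline u) = F := by
  classical
  unfold freeStep
  simp only [if_neg hu]

open Classical in
theorem mem_freeStep_deadline {F : Finset V} {u w : V} (hu : u ∈ F) :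
    w ∈ freeStep G o K F (.deadline u) ↔
      w ≠ u ∧ w ∈ F ∧ bestOf (o u) (F.filter (G.Adj u)) ≠ some w := by
  unfold freeStep
  simp only [if_pos hu, Finset.mem_filter, Finset.mem_erase, and_assoc]

theorem freeStep_deadline_subset {F : Finset V} {u w : V}
    (h : w ∈ freeStep G o K F (.deadline u)) : w ∈ F := by
  by_cases hu : u ∈ F
  · exact ((mem_freeStep_deadline hu).1 h).2.1
  · rwa [freeStep_deadline_of_notMem hu] at h

/-- Follow the extra vertex `z`. If `z` itself departs and takes `w`, then `w` is now extra in the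
other run and lies on the other side. If some vertex takes `z`, in the other run it takes a `w` on
the side of `z`, which becomes the new extra vertex, or it takes nothing and the runs merge.
Otherwise, in the absence of ties, both runs make the same choice. -/
theorem extraAtMost_deadline (ho : ∀ u, Function.Injective (o u)) {col : V → Bool}
    (hcol : ∀ u v, G.Adj u v → col u ≠ col v) {c : Bool} {K K' : Set V} {F F' : Finset V}
    (h : ExtraAtMost col c F F') (u : V) :
    ExtraAtMost col c (freeStep G o K F (.deadline u)) (freeStep G o K' F' (.deadline u)) ∨
    ExtraAtMost col (!c) (freeStep G o K' F' (.deadline u)) (freeStep G o K F (.deadline u)) := by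
  classical
  rcases h with rfl | ⟨z, hz, hzc, hF⟩
  · exact Or.inl (Or.inl (by unfold freeStep; rfl))
  by_cases huz : u = z
  · subst huz
    have huF : u ∈ F := (hF u).2 (Or.inl rfl)
    rw [freeStep_deadline_of_notMem hz]
    rcases hb : bestOf (o u) (F.filter (G.Adj u)) with _ | w
    · refine Or.inl (Or.inl ?_)
      ext a
      rw [mem_freeStep_deadline huF, hb, hF]
      constructor
      · rintro ⟨h1, h2 | h2, -⟩
        · exact absurd h2 h1
        · exact h2
      · exact fun h => ⟨fun e => hz (e ▸ h), Or.inr h, by simp⟩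
    · have hw := Finset.mem_filter.1 (bestOf_spec hb).1
      have hwu : w ≠ u := fun e => G.loopless.irrefl u (by simpa [e] using hw.2)
      refine Or.inr (Or.inr ⟨w, ?_, ?_, fun a => ?_⟩)
      · rw [mem_freeStep_deadline huF, hb]
        simp
      · have := hcol u w hw.2
        rw [hzc] at this
        cases c <;> cases hcw : col w <;> simp_all
      · rw [mem_freeStep_deadline huF, hb, hF]
        have hwF : w ∈ F' := ((hF w).1 hw.1).resolve_left hwu
        constructor
        · intro h
          by_cases e : a = w
          · exact Or.inl e
          · exact Or.inr ⟨fun e' => hz (e' ▸ h), Or.inr h, fun e' => e (Option.some.inj e').symm⟩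
        · rintro (rfl | ⟨h1, h2 | h2, -⟩)
          · exact hwF
          · exact absurd h2 h1
          · exact h2
  by_cases huF' : u ∈ F'
  swap
  · have huF : u ∉ F := fun h => ((hF u).1 h).elim huz huF'
    rw [freeStep_deadline_of_notMem huF', freeStep_deadline_of_notMem huF]
    exact Or.inl (Or.inr ⟨z, hz, hzc, hF⟩)
  have huF : u ∈ F := (hF u).2 (Or.inr huF')
  left
  by_cases hbz : bestOf (o u) (F.filter (G.Adj u)) = some z
  · have hzu := Finset.mem_filter.1 (bestOf_spec hbz).1
    rcases hb' : bestOf (o u) (F'.filter (G.Adj u)) with _ | w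
    · refine Or.inl ?_
      ext a
      rw [mem_freeStep_deadline huF, mem_freeStep_deadline huF', hbz, hb', hF]
      constructor
      · rintro ⟨h1, h2 | h2, h3⟩
        · exact absurd (congrArg some h2.symm) h3
        · exact ⟨h1, h2, by simp⟩
      · rintro ⟨h1, h2, -⟩
        exact ⟨h1, Or.inr h2, fun e => hz (Option.some.inj e ▸ h2)⟩
    · have hw := Finset.mem_filter.1 (bestOf_spec hb').1
      refine Or.inr ⟨w, ?_, ?_, fun a => ?_⟩
      · rw [mem_freeStep_deadline huF', hb']
        simp
      · have h1 := hcol u w hw.2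
        have h2 := hcol u z hzu.2
        rw [hzc] at h2
        revert h1 h2
        cases c <;> cases col w <;> cases col u <;> simp
      · rw [mem_freeStep_deadline huF, mem_freeStep_deadline huF', hbz, hb', hF]
        constructor
        · rintro ⟨h1, h2 | h2, h3⟩
          · exact absurd (congrArg some h2.symm) h3
          · by_cases e : a = w
            · exact Or.inl e
            · exact Or.inr ⟨h1, h2, fun e' => e (Option.some.inj e').symm⟩
        · rintro (rfl | ⟨h1, h2, -⟩)
          · exact ⟨fun e => G.loopless.irrefl u (by simpa [e] using hw.2), Or.inr hw.1,
              fun e => hz (Option.some.inj e ▸ hw.1)⟩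
          · exact ⟨h1, Or.inr h2, fun e => hz (Option.some.inj e ▸ h2)⟩
  · have hbb : bestOf (o u) (F.filter (G.Adj u)) = bestOf (o u) (F'.filter (G.Adj u)) := by
      rcases hb : bestOf (o u) (F.filter (G.Adj u)) with _ | w
      · rw [bestOf_eq_none] at hb
        refine (bestOf_eq_none.2 ?_).symm
        rw [Finset.filter_eq_empty_iff] at hb ⊢
        exact fun a ha => hb ((hF a).2 (Or.inr ha))
      · have hw := bestOf_spec hb
        have hw1 := Finset.mem_filter.1 hw.1
        have hwz : w ≠ z := fun e => hbz (e ▸ hb)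
        refine (bestOf_eq_some (ho u) (Finset.mem_filter.2
          ⟨((hF w).1 hw1.1).resolve_left hwz, hw1.2⟩) fun a ha => hw.2 a ?_).symm
        rw [Finset.mem_filter] at ha ⊢
        exact ⟨(hF a).2 (Or.inr ha.1), ha.2⟩
    refine Or.inr ⟨z, fun h => hz (freeStep_deadline_subset h), hzc, fun a => ?_⟩
    rw [mem_freeStep_deadline huF, mem_freeStep_deadline huF', ← hbb, hF]
    constructor
    · rintro ⟨h1, h2 | h2, h3⟩
      · exact Or.inl h2
      · exact Or.inr ⟨h1, h2, h3⟩
    · rintro (rfl | ⟨h1, h2, h3⟩)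
      · exact ⟨fun e => huz e.symm, Or.inl rfl, hbz⟩
      · exact ⟨h1, Or.inr h2, h3⟩

theorem extraAtMost_arrival {col : V → Bool} {c : Bool} {K K' : Set V} {F F' : Finset V} {a : V}
    (h : ExtraAtMost col c F F') (ha : a ∈ K ↔ a ∈ K') (haF : a ∉ F) :
    ExtraAtMost col c (freeStep G o K F (.arrival a)) (freeStep G o K' F' (.arrival a)) := by
  classical
  by_cases hK : a ∈ K
  · rwa [freeStep_arrival_of_mem hK, freeStep_arrival_of_mem (ha.1 hK)]
  · rcases h with rfl | ⟨z, hz, hzc, hF⟩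
    · left
      ext w
      rw [freeStep_arrival_mem hK, freeStep_arrival_mem (fun h => hK (ha.2 h))]
    · refine Or.inr ⟨z, ?_, hzc, fun w => ?_⟩
      · rw [freeStep_arrival_mem (fun h => hK (ha.2 h))]
        rintro (rfl | h)
        · exact haF ((hF z).2 (Or.inl rfl))
        · exact hz h
      · rw [freeStep_arrival_mem hK, freeStep_arrival_mem (fun h => hK (ha.2 h)), hF]
        tauto

variable {I : FullyOnlineInstance V}

/-- The alternating path property: the arrival of `v` changes the availability of at most one
vertex, in the direction given by the colour of that vertex. -/
theorem extraAtMost_freeRun (ho : ∀ u, Function.Injective (o u)) {col : V → Bool}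
    (hcol : ∀ u v, I.graph.Adj u v → col u ≠ col v) {v : V} (hv : v ∉ K)
    {p : List (OnlineEvent V)} (hp : p <+: I.events) :
    (OnlineEvent.arrival v ∉ p →
      freeRun I.graph o K p = freeRun I.graph o (insert v K) p) ∧
    (ExtraAtMost col (col v) (freeRun I.graph o K p) (freeRun I.graph o (insert v K) p) ∨
      ExtraAtMost col (!col v) (freeRun I.graph o (insert v K) p) (freeRun I.graph o K p)) := by
  classical
  revert hp
  refine prefix_induction (I := I) (motive := fun p =>
    (OnlineEvent.arrival v ∉ p →
      freeRun I.graph o K p = freeRun I.graph o (insert v K) p) ∧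
    (ExtraAtMost col (col v) (freeRun I.graph o K p) (freeRun I.graph o (insert v K) p) ∨
      ExtraAtMost col (!col v) (freeRun I.graph o (insert v K) p) (freeRun I.graph o K p)))
    ?_ ?_ p
  · exact ⟨fun _ => rfl, Or.inl (Or.inl rfl)⟩
  · rintro p e hp ⟨ih1, ih2⟩
    rw [freeRun_append, freeRun_append]
    rcases e with a | u
    · have haF : ∀ K : Set V, a ∉ freeRun I.graph o K p := fun K h =>
        notMem_of_prefix hp (mem_freeRun h).2
      by_cases hav : a = v
      · subst hav
        refine ⟨fun h => absurd (by simp) h, Or.inl (Or.inr ⟨a, ?_, rfl, fun w => ?_⟩)⟩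
        · rw [freeStep_arrival_of_mem (Set.mem_insert a K)]
          exact haF _
        · rw [freeStep_arrival_of_mem (Set.mem_insert a K), freeStep_arrival_mem hv,
            ih1 (notMem_of_prefix hp)]
      · have hK : a ∈ K ↔ a ∈ insert v K := by simp [hav]
        refine ⟨fun h => ?_, ?_⟩
        · rw [ih1 fun h' => h (List.mem_append_left _ h')]
          by_cases haK : a ∈ K
          · rw [freeStep_arrival_of_mem haK, freeStep_arrival_of_mem (hK.1 haK)]
          · ext w
            rw [freeStep_arrival_mem haK, freeStep_arrival_mem fun h => haK (hK.2 h)]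
        · exact ih2.imp (fun h => extraAtMost_arrival h hK (haF _))
            fun h => extraAtMost_arrival h hK.symm (haF _)
    · refine ⟨fun h => ?_, ?_⟩
      · rw [ih1 fun h' => h (List.mem_append_left _ h')]
        unfold freeStep
        rfl
      · rcases ih2 with h | h
        · exact extraAtMost_deadline ho hcol h u
        · have := extraAtMost_deadline (K := insert v K) (K' := K) ho hcol h u
          rw [Bool.not_not] at this
          exact this.symm

/-- The only vertex that the presence of `v` can make unavailable lies on the side opposite to `v`.
-/
theorem mem_freeRun_of_same_color (ho : ∀ u, Function.Injective (o u)) {col : V → Bool}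
    (hcol : ∀ u v, I.graph.Adj u v → col u ≠ col v) {v a : V} (hv : v ∉ K)
    {p : List (OnlineEvent V)} (hp : p <+: I.events) (hav : col a = col v)
    (ha : a ∈ freeRun I.graph o (insert v K) p) : a ∈ freeRun I.graph o K p := by
  rcases (extraAtMost_freeRun ho hcol hv hp).2 with (h | ⟨z, -, -, h⟩) | (h | ⟨z, -, hz, h⟩)
  · rwa [h]
  · exact (h a).2 (Or.inr ha)
  · rwa [← h]
  · refine ((h a).1 ha).resolve_left ?_
    rintro rfl
    rw [hav] at hz
    cases hc : col v <;> simp [hc] at hz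

/-- Dually, the only vertex that the presence of `v` can add to the available ones lies on the side
of `v`. -/
theorem mem_freeRun_of_other_color (ho : ∀ u, Function.Injective (o u)) {col : V → Bool}
    (hcol : ∀ u v, I.graph.Adj u v → col u ≠ col v) {v a : V} (hv : v ∉ K)
    {p : List (OnlineEvent V)} (hp : p <+: I.events) (hav : col a ≠ col v)
    (ha : a ∈ freeRun I.graph o K p) : a ∈ freeRun I.graph o (insert v K) p := by
  rcases (extraAtMost_freeRun ho hcol hv hp).2 with (h | ⟨z, -, hz, h⟩) | (h | ⟨z, -, -, h⟩)
  · rwa [← h]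
  · refine ((h a).1 ha).resolve_left ?_
    rintro rfl
    exact hav hz
  · rwa [h]
  · exact (h a).2 (Or.inr ha)

/-- `u` beats the available neighbours (without `u` and `K`) of some available vertex whose
deadline is in `p`. -/
def Outbids (G : SimpleGraph V) (o : V → V → ℝ) (K : Set V) (p : List (OnlineEvent V)) (u : V) :
    Prop :=
  ∃ q z, q ++ [OnlineEvent.deadline z] <+: p ∧ z ∈ freeRun G o (insert u K) q ∧ G.Adj z u ∧
    OnlineEvent.arrival u ∈ q ∧ ∀ a ∈ freeRun G o (insert u K) q, G.Adj z a → o z a < o z u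

theorem Outbids.mono {p p' : List (OnlineEvent V)} {u : V} (h : Outbids G o K p u) (hp : p <+: p') :
    Outbids G o K p' u := by
  obtain ⟨q, z, hq, h⟩ := h
  exact ⟨q, z, hq.trans hp, h⟩

/-- As long as `u` wins no contest, all choices are the same with and without it, and `u` merely
waits among the available vertices. -/
theorem freeRun_of_not_outbids (ho : ∀ u, Function.Injective (o u)) {u : V} (hu : u ∉ K)
    {p : List (OnlineEvent V)} (hp : p <+: I.events) (hdl : OnlineEvent.deadline u ∉ p)
    (hout : ¬ Outbids I.graph o K p u) (w : V) :
    w ∈ freeRun I.graph o K p ↔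
      (w = u ∧ OnlineEvent.arrival u ∈ p) ∨ w ∈ freeRun I.graph o (insert u K) p := by
  classical
  revert hp hdl hout w
  refine prefix_induction (I := I) (motive := fun p =>
    OnlineEvent.deadline u ∉ p → ¬ Outbids I.graph o K p u → ∀ w,
    (w ∈ freeRun I.graph o K p ↔
      (w = u ∧ OnlineEvent.arrival u ∈ p) ∨ w ∈ freeRun I.graph o (insert u K) p)) ?_ ?_ p
  · intro _ _ w
    simp [freeRun]
  · intro p e hp ih hdl hout
    have ih := ih (fun h => hdl (List.mem_append_left _ h))
      fun h => hout (h.mono (List.prefix_append _ _))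
    intro w
    rw [freeRun_append, freeRun_append]
    rcases e with a | z
    · by_cases hau : a = u
      · subst hau
        have h1 : OnlineEvent.arrival a ∉ p := notMem_of_prefix hp
        rw [freeStep_arrival_mem hu, freeStep_arrival_of_mem (Set.mem_insert a K), ih]
        simp [h1]
      · have hK : a ∈ K ↔ a ∈ insert u K := by simp [hau]
        have hau' : u ≠ a := fun h => hau h.symm
        by_cases haK : a ∈ K
        · rw [freeStep_arrival_of_mem haK, freeStep_arrival_of_mem (hK.1 haK), ih]
          simp [hau']
        · rw [freeStep_arrival_mem haK, freeStep_arrival_mem fun h => haK (hK.2 h), ih]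
          simp only [List.mem_append, List.mem_singleton, OnlineEvent.arrival.injEq, hau', or_false]
          tauto
    · have hzu : z ≠ u := by
        rintro rfl
        simp at hdl
      have harr : OnlineEvent.arrival u ∈ p ++ [OnlineEvent.deadline z] ↔
          OnlineEvent.arrival u ∈ p := by simp
      rw [harr]
      by_cases hz' : z ∈ freeRun I.graph o (insert u K) p
      swap
      · have hz : z ∉ freeRun I.graph o K p := fun h => ((ih z).1 h).elim (fun h => hzu h.1) hz'
        rw [freeStep_deadline_of_notMem hz, freeStep_deadline_of_notMem hz', ih]
      have hz : z ∈ freeRun I.graph o K p := (ih z).2 (Or.inr hz')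
      have huF' : u ∉ freeRun I.graph o (insert u K) p := fun h =>
        (mem_freeRun h).1 (Set.mem_insert u K)
      have hbu : bestOf (o z) ((freeRun I.graph o K p).filter (I.graph.Adj z)) ≠ some u := by
        intro hb
        have h1 := bestOf_spec hb
        have h2 := Finset.mem_filter.1 h1.1
        refine hout ⟨p, z, List.prefix_refl _, hz', h2.2, (mem_freeRun h2.1).2, fun a ha haz => ?_⟩
        refine lt_of_le_of_ne (h1.2 a (Finset.mem_filter.2 ⟨(ih a).2 (Or.inr ha), haz⟩)) fun e => ?_
        exact huF' (ho z e ▸ ha)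
      have hbb : bestOf (o z) ((freeRun I.graph o K p).filter (I.graph.Adj z)) =
          bestOf (o z) ((freeRun I.graph o (insert u K) p).filter (I.graph.Adj z)) := by
        rcases hb : bestOf (o z) ((freeRun I.graph o K p).filter (I.graph.Adj z)) with _ | b
        · rw [bestOf_eq_none] at hb
          refine (bestOf_eq_none.2 ?_).symm
          rw [Finset.filter_eq_empty_iff] at hb ⊢
          exact fun a ha => hb ((ih a).2 (Or.inr ha))
        · have hw := bestOf_spec hb
          have hw1 := Finset.mem_filter.1 hw.1
          have hwz : b ≠ u := fun e => hbu (e ▸ hb)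
          refine (bestOf_eq_some (ho z) (Finset.mem_filter.2
            ⟨((ih b).1 hw1.1).resolve_left fun h => hwz h.1, hw1.2⟩) fun a ha => hw.2 a ?_).symm
          rw [Finset.mem_filter] at ha ⊢
          exact ⟨(ih a).2 (Or.inr ha.1), ha.2⟩
      rw [mem_freeStep_deadline hz, mem_freeStep_deadline hz', ← hbb, ih]
      constructor
      · rintro ⟨h1, h2 | h2, h3⟩
        · exact Or.inl h2
        · exact Or.inr ⟨h1, h2, h3⟩
      · rintro (⟨rfl, h⟩ | ⟨h1, h2, h3⟩)
        · exact ⟨fun e => hzu e.symm, Or.inl ⟨rfl, h⟩, hbu⟩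
        · exact ⟨h1, Or.inr h2, h3⟩

/-- Up to the first contest that `u` would win, the runs with and without `u` differ only by `u`. So
`u` is really chosen there, and a matched vertex never becomes available again. -/
theorem notMem_freeRun_of_outbids (ho : ∀ u, Function.Injective (o u)) {u : V} (hu : u ∉ K)
    {p : List (OnlineEvent V)} (hp : p <+: I.events) (hdl : OnlineEvent.deadline u ∉ p)
    (hout : Outbids I.graph o K p u) : u ∉ freeRun I.graph o K p := by
  classical
  revert hp hdl hout
  refine prefix_induction (I := I) (motive := fun p =>
    OnlineEvent.deadline u ∉ p → Outbids I.graph o K p u → u ∉ freeRun I.graph o K p) ?_ ?_ p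
  · rintro _ ⟨q, z, hq, -⟩
    have := List.prefix_nil.1 hq
    simp at this
  · intro p e hp ih hdl hout
    have hdl' : OnlineEvent.deadline u ∉ p := fun h => hdl (List.mem_append_left _ h)
    rw [freeRun_append]
    by_cases hout' : Outbids I.graph o K p u
    · have hn := ih hdl' hout'
      rcases e with a | z
      · have hua : u ≠ a := by
          rintro rfl
          obtain ⟨q, z, hq, -, -, hq', -⟩ := hout'
          exact notMem_of_prefix hp (hq.subset (List.mem_append_left _ hq'))
        by_cases haK : a ∈ K
        · rwa [freeStep_arrival_of_mem haK]
        · rw [freeStep_arrival_mem haK]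
          exact fun h => h.elim hua hn
      · exact fun h => hn (freeStep_deadline_subset h)
    · obtain ⟨q, z, hq, hz', hzu, harr, hmax⟩ := hout
      have heq : q ++ [OnlineEvent.deadline z] = p ++ [e] := by
        rcases List.prefix_concat_iff.1 hq with h | h
        · exact h
        · exact absurd ⟨q, z, h, hz', hzu, harr, hmax⟩ hout'
      obtain ⟨rfl, he⟩ := List.append_inj' heq rfl
      rw [List.singleton_inj] at he
      subst he
      have key := freeRun_of_not_outbids ho hu (prefix_of_append hp) hdl' hout'
      rw [mem_freeStep_deadline ((key z).2 (Or.inr hz'))]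
      rintro ⟨-, -, hb⟩
      refine hb (bestOf_eq_some (ho z) (Finset.mem_filter.2 ⟨(key u).2 (Or.inl ⟨rfl, harr⟩), hzu⟩)
        fun a ha => ?_)
      rw [Finset.mem_filter, key] at ha
      rcases ha with ⟨⟨rfl, -⟩ | ha, haz⟩
      · exact le_rfl
      · exact (hmax a ha haz).le

end BalancedRanking

/-! ### The state of Balanced Ranking in terms of the available vertices. -/

namespace MatchState

variable {V : Type*} {G : SimpleGraph V} {S : MatchState V} {u v : V} {offer : V → ℝ}

open Classical in
/-- The present unmatched vertices. -/
noncomputable def free (S : MatchState V) : Finset V :=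
  S.present.filter fun v => ¬ S.IsMatched v

open Classical in
/-- The vertex to which `u` is matched at its deadline, if any. -/
noncomputable def partner (G : SimpleGraph V) (S : MatchState V) (u : V) (offer : V → ℝ) :
    Option V :=
  if S.IsMatched u then none else BalancedRanking.bestOf offer (S.available G u)

open Classical in
theorem depart_matching : (S.depart G u offer).matching =
    (S.partner G u offer).elim S.matching fun w => insert s(u, w) S.matching := by
  unfold depart partner
  by_cases hu : S.IsMatched u
  · simp [hu]
  · by_cases hne : (S.bestOffers G u offer).Nonempty
    · have : BalancedRanking.bestOf offer (S.available G u) = some hne.choose := by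
        unfold BalancedRanking.bestOf
        exact dif_pos hne
      simp [hu, hne, this]
    · have : BalancedRanking.bestOf offer (S.available G u) = none := by
        unfold BalancedRanking.bestOf
        exact dif_neg hne
      simp [hu, hne, this]

theorem isMatched_depart : (S.depart G u offer).IsMatched v ↔
    S.IsMatched v ∨ ∃ w, S.partner G u offer = some w ∧ (v = u ∨ v = w) := by
  classical
  unfold IsMatched
  rw [depart_matching]
  rcases S.partner G u offer with _ | w
  · simp
  · simp only [Option.elim_some, Finset.mem_insert, exists_eq_or_imp, Sym2.mem_iff,
      Option.some.injEq, exists_eq_left']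
    exact or_comm

theorem partner_eq_some {w : V} (h : S.partner G u offer = some w) :
    ¬ S.IsMatched u ∧ G.Adj u w ∧ w ∈ S.present ∧ ¬ S.IsMatched w := by
  classical
  unfold partner at h
  split_ifs at h with hu
  have := (BalancedRanking.bestOf_spec h).1
  rw [available, Finset.mem_filter] at this
  exact ⟨hu, this.2.1, this.1, this.2.2⟩

end MatchState

namespace BalancedRanking

open FullyOnlineInstance

variable {V : Type*} {G : SimpleGraph V} {f g : ℝ → ℝ} {x : V → V → ℝ} {y : V → ℝ}

/-- The offer of `v` at the deadline of `u`. -/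
noncomputable def offers (f g : ℝ → ℝ) (x : V → V → ℝ) (y : V → ℝ) (u v : V) : ℝ :=
  1 - g (y v) - f (x u v)

theorem run_append (l : List (OnlineEvent V)) (e : OnlineEvent V) :
    run G f g x y (l ++ [e]) = step G f g x y (run G f g x y l) e := by
  simp [run]

theorem run_append_deadline (l : List (OnlineEvent V)) (u : V) :
    run G f g x y (l ++ [.deadline u]) =
      (run G f g x y l).depart G u (offers f g x y u) := by
  rw [run_append]
  rfl

theorem isMatched_run_arrival (l : List (OnlineEvent V)) (u v : V) :
    (run G f g x y (l ++ [.arrival u])).IsMatched v ↔ (run G f g x y l).IsMatched v := by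
  rw [run_append]
  rfl

theorem arrival_mem_of_mem_present {l : List (OnlineEvent V)} {v : V}
    (h : v ∈ (run G f g x y l).present) : OnlineEvent.arrival v ∈ l := by
  classical
  induction l using List.reverseRecOn with
  | nil => simp [run, MatchState.init] at h
  | append_singleton l e ih =>
    rw [run_append] at h
    rcases e with u | u
    · simp only [step, MatchState.arrive, Finset.mem_insert] at h
      rcases h with rfl | h
      · simp
      · simp [ih h]
    · simp only [step, MatchState.depart, Finset.mem_erase] at h
      simp [ih h.2]

variable {I : FullyOnlineInstance V} {p : List (OnlineEvent V)}

theorem mem_present_run {v : V} (hp : p <+: I.events) :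
    v ∈ (run I.graph f g x y p).present ↔
      OnlineEvent.arrival v ∈ p ∧ OnlineEvent.deadline v ∉ p := by
  classical
  revert hp
  refine prefix_induction (I := I) (motive := fun p => v ∈ (run I.graph f g x y p).present ↔
      OnlineEvent.arrival v ∈ p ∧ OnlineEvent.deadline v ∉ p) ?_ ?_ p
  · simp [run, MatchState.init]
  · intro p e hp ih
    rw [run_append]
    rcases e with u | u
    · simp only [step, MatchState.arrive, Finset.mem_insert, ih, List.mem_append,
        List.mem_singleton, OnlineEvent.arrival.injEq, reduceCtorEq, or_false]
      by_cases hvu : v = u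
      · subst hvu
        simp only [true_or, or_true, true_and, true_iff]
        exact fun h => notMem_of_prefix hp (arrival_mem_of_deadline_mem (prefix_of_append hp) h)
      · simp [hvu]
    · simp only [step, MatchState.depart, Finset.mem_erase, ih, List.mem_append,
        List.mem_singleton, OnlineEvent.deadline.injEq, reduceCtorEq, or_false]
      tauto

theorem arrival_mem_of_isMatched {v : V} (hp : p <+: I.events)
    (h : (run I.graph f g x y p).IsMatched v) : OnlineEvent.arrival v ∈ p := by
  revert hp h
  refine prefix_induction (I := I) (motive := fun p =>
    (run I.graph f g x y p).IsMatched v → OnlineEvent.arrival v ∈ p) ?_ ?_ p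
  · rintro ⟨e, he, -⟩
    simp [run, MatchState.init] at he
  · intro p e hp ih h
    rcases e with u | u
    · rw [isMatched_run_arrival] at h
      exact List.mem_append_left _ (ih h)
    · rw [run_append_deadline, MatchState.isMatched_depart] at h
      rcases h with h | ⟨w, hw, rfl | rfl⟩
      · exact List.mem_append_left _ (ih h)
      · exact List.mem_append_left _ (arrival_mem_of_prefix hp)
      · exact List.mem_append_left _
          (arrival_mem_of_mem_present (MatchState.partner_eq_some hw).2.2.1)

open Classical in
theorem available_eq (S : MatchState V) (u : V) : S.available G u = S.free.filter (G.Adj u) := by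
  ext v
  simp only [MatchState.available, MatchState.free, Finset.mem_filter]
  tauto

/-- The choices depend on the state only through the available vertices, so the algorithm is the
deletion dynamics with nothing deleted. -/
theorem free_run (hp : p <+: I.events) :
    (run I.graph f g x y p).free = freeRun I.graph (offers f g x y) ∅ p := by
  classical
  revert hp
  refine prefix_induction (I := I) (motive := fun p =>
    (run I.graph f g x y p).free = freeRun I.graph (offers f g x y) ∅ p) ?_ ?_ p
  · exact Finset.filter_empty _
  · intro p e hp ih
    rw [freeRun_append, ← ih]
    rcases e with u | u
    · ext v
      rw [freeStep_arrival_mem (Set.notMem_empty u), MatchState.free, Finset.mem_filter,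
        isMatched_run_arrival, run_append, MatchState.free, Finset.mem_filter]
      simp only [step, MatchState.arrive, Finset.mem_insert]
      have hu : ¬ (run I.graph f g x y p).IsMatched u := fun h =>
        notMem_of_prefix hp (arrival_mem_of_isMatched (prefix_of_append hp) h)
      by_cases hvu : v = u
      · simp [hvu, hu]
      · simp [hvu]
    · have hu : u ∈ (run I.graph f g x y p).present :=
        (mem_present_run (prefix_of_append hp)).2 ⟨arrival_mem_of_prefix hp, notMem_of_prefix hp⟩
      rw [run_append_deadline]
      set S := run I.graph f g x y p
      ext v
      by_cases hm : S.IsMatched u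
      · rw [freeStep_deadline_of_notMem (by simp [MatchState.free, hm])]
        rw [MatchState.free, Finset.mem_filter, MatchState.isMatched_depart, MatchState.free,
          Finset.mem_filter]
        simp only [MatchState.partner, hm, if_true, MatchState.depart, Finset.mem_erase]
        constructor
        · rintro ⟨h1, h2⟩
          exact ⟨h1.2, fun h => h2 (Or.inl h)⟩
        · rintro ⟨h1, h2⟩
          exact ⟨⟨fun e => h2 (e ▸ hm), h1⟩, by simp [h2]⟩
      · rw [mem_freeStep_deadline (by simp [MatchState.free, hm, hu]), ← available_eq]
        rw [MatchState.free, Finset.mem_filter, MatchState.isMatched_depart, MatchState.free,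
          Finset.mem_filter]
        simp only [MatchState.partner, hm, if_false, MatchState.depart, Finset.mem_erase]
        constructor
        · rintro ⟨⟨h1, h2⟩, h3⟩
          exact ⟨h1, ⟨h2, fun h => h3 (Or.inl h)⟩, fun h => h3 (Or.inr ⟨v, h, Or.inr rfl⟩)⟩
        · rintro ⟨h1, ⟨h2, h3⟩, h4⟩
          refine ⟨⟨h1, h2⟩, ?_⟩
          rintro (h | ⟨w, hw, rfl | rfl⟩)
          · exact h3 h
          · exact h1 rfl
          · exact h4 hw

/-- A present vertex is matched if and only if it is not free. -/
theorem isMatched_run_iff {v : V} (hp : p <+: I.events) (ha : OnlineEvent.arrival v ∈ p)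
    (hd : OnlineEvent.deadline v ∉ p) :
    (run I.graph f g x y p).IsMatched v ↔ v ∉ freeRun I.graph (offers f g x y) ∅ p := by
  classical
  rw [← free_run hp, MatchState.free, Finset.mem_filter, mem_present_run hp]
  simp [ha, hd]

open Classical in
theorem partner_run {u : V} (hp : p ++ [.deadline u] <+: I.events) :
    (run I.graph f g x y p).partner I.graph u (offers f g x y u) =
      if u ∈ freeRun I.graph (offers f g x y) ∅ p then
        bestOf (offers f g x y u)
          ((freeRun I.graph (offers f g x y) ∅ p).filter (I.graph.Adj u))
      else none := by
  rw [MatchState.partner, available_eq, free_run (prefix_of_append hp)]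
  by_cases h : u ∈ freeRun I.graph (offers f g x y) ∅ p
  · rw [if_neg, if_pos h]
    rw [isMatched_run_iff (prefix_of_append hp) (arrival_mem_of_prefix hp) (notMem_of_prefix hp)]
    exact not_not.2 h
  · rw [if_pos, if_neg h]
    rwa [isMatched_run_iff (prefix_of_append hp) (arrival_mem_of_prefix hp) (notMem_of_prefix hp)]

theorem bestOf_congr {o o' : V → ℝ} {A : Finset V} (h : ∀ a ∈ A, o a = o' a) :
    bestOf o A = bestOf o' A := by
  classical
  have : (A.filter fun v => ∀ w ∈ A, o w ≤ o v) = A.filter fun v => ∀ w ∈ A, o' w ≤ o' v := by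
    refine Finset.filter_congr fun v hv => forall₂_congr fun w hw => ?_
    rw [h v hv, h w hw]
  unfold bestOf
  simp only [this]

/-- The offers of deleted vertices are never consulted. In particular, the run without `u` and `v`
does not depend on their ranks. -/
theorem freeRun_congr {o o' : V → V → ℝ} {K : Set V} (h : ∀ z, ∀ a ∉ K, o z a = o' z a)
    (l : List (OnlineEvent V)) : freeRun G o K l = freeRun G o' K l := by
  classical
  induction l using List.reverseRecOn with
  | nil => rfl
  | append_singleton l e ih =>
    rw [freeRun_append, freeRun_append, ← ih]
    rcases e with u | u
    · rfl
    · unfold freeStep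
      simp only
      rw [bestOf_congr fun a ha => h u a (mem_freeRun (Finset.mem_filter.1 ha).1).1]

theorem Outbids.congr {o o' : V → V → ℝ} {K : Set V} {u : V}
    (h : ∀ z, ∀ a ∉ insert u K, o z a = o' z a) (hu : ∀ z, o z u ≤ o' z u)
    (hout : Outbids G o K p u) : Outbids G o' K p u := by
  obtain ⟨q, z, hq, hz, hzu, ha, hmax⟩ := hout
  rw [freeRun_congr h] at hz hmax
  exact ⟨q, z, hq, hz, hzu, ha, fun a haf haz =>
    (h z a (mem_freeRun haf).1 ▸ hmax a haf haz).trans_le (hu z)⟩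

end BalancedRanking

/-! ### One edge, with the ranks fixed: comparison with the run without both endpoints. -/

namespace BalancedRanking

open FullyOnlineInstance

variable {V : Type*} {o : V → V → ℝ} {I : FullyOnlineInstance V} {col : V → Bool}
  {p : List (OnlineEvent V)} {u v : V}

/-- `u` is taken early in the run without `v`; restoring `v`, which is on the other side, cannot
make `u` available again. -/
theorem notMem_freeRun_of_outbids_pair (ho : ∀ u, Function.Injective (o u))
    (hcol : ∀ u v, I.graph.Adj u v → col u ≠ col v) (huv : col u ≠ col v)
    (hp : p <+: I.events) (hdl : OnlineEvent.deadline u ∉ p)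
    (hout : Outbids I.graph o {v} p u) : u ∉ freeRun I.graph o ∅ p := fun h => by
  have hne : u ≠ v := fun e => huv (congrArg col e)
  refine notMem_freeRun_of_outbids ho (K := {v}) hne hp hdl hout ?_
  have := mem_freeRun_of_other_color ho hcol (Set.notMem_empty v) hp huv h
  simpa using this

/-- Restore the two vertices one after the other. Adding `u`, which wins nothing, affects no other
vertex; adding `v`, which is on the side of `w`, cannot remove `w`. -/
theorem mem_freeRun_of_not_outbids_pair (ho : ∀ u, Function.Injective (o u))
    (hcol : ∀ u v, I.graph.Adj u v → col u ≠ col v) (huv : col u ≠ col v)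
    (hp : p <+: I.events) (hdl : OnlineEvent.deadline u ∉ p)
    (hout : ¬ Outbids I.graph o {v} p u) {w : V} (hw : w ∈ freeRun I.graph o {u, v} p)
    (huw : I.graph.Adj u w) : w ∈ freeRun I.graph o ∅ p := by
  have hne : u ≠ v := fun e => huv (congrArg col e)
  have h1 := (freeRun_of_not_outbids ho (K := {v}) hne hp hdl hout w).2 (Or.inr hw)
  have hwv : col w = col v := by
    have := hcol u w huw
    revert this huv
    cases col u <;> cases col v <;> cases col w <;> simp
  exact mem_freeRun_of_same_color ho hcol (Set.notMem_empty v) hp hwv (by simpa using h1)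

theorem mem_freeRun_iff_of_not_outbids_pair (ho : ∀ u, Function.Injective (o u)) (huv : u ≠ v)
    (hp : p <+: I.events) (hu : OnlineEvent.deadline u ∉ p) (hv : OnlineEvent.deadline v ∉ p)
    (hau : OnlineEvent.arrival u ∈ p) (hav : OnlineEvent.arrival v ∈ p)
    (hout : ¬ Outbids I.graph o {v} p u) (hout' : ¬ Outbids I.graph o {u} p v) (w : V) :
    w ∈ freeRun I.graph o ∅ p ↔ w = u ∨ w = v ∨ w ∈ freeRun I.graph o {u, v} p := by
  have key : ∀ q, q <+: p → ∀ w, w ∈ freeRun I.graph o {u} q ↔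
      (w = v ∧ OnlineEvent.arrival v ∈ q) ∨ w ∈ freeRun I.graph o {u, v} q := fun q hq w => by
    have := freeRun_of_not_outbids ho (K := {u}) (u := v) huv.symm (hq.trans hp)
      (fun h => hv (hq.subset h)) (fun h => hout' (h.mono hq)) w
    rwa [Set.pair_comm] at this
  -- A contest won by `u` with `v` present is also won without `v`: there are fewer competitors, and
  -- the departing vertex is not `v`, whose deadline is still to come.
  have hout0 : ¬ Outbids I.graph o ∅ p u := by
    rintro ⟨q, z, hq, hz, hzu, ha, hmax⟩
    have hqp : q <+: p := (List.prefix_append _ _).trans hq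
    simp only [insert_empty_eq] at hz hmax
    refine hout ⟨q, z, hq, ((key q hqp z).1 hz).resolve_left ?_, hzu, ha,
      fun a haf haz => hmax a ((key q hqp a).2 (Or.inr haf)) haz⟩
    rintro ⟨rfl, -⟩
    exact hv (hq.subset (by simp))
  rw [freeRun_of_not_outbids ho (Set.notMem_empty u) hp hu hout0]
  simp only [insert_empty_eq, hau, and_true]
  rw [key p (List.prefix_refl p)]
  simp [hav]

/-- The smallest nonnegative upper bound of finitely many offers. -/
theorem exists_nonneg_best (A : Finset V) (h : V → ℝ) :
    ∃ σ : ℝ, 0 ≤ σ ∧ (∀ a ∈ A, h a ≤ σ) ∧ (σ = 0 ∨ ∃ a ∈ A, σ = h a) := by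
  classical
  rcases A.eq_empty_or_nonempty with rfl | hA
  · exact ⟨0, le_rfl, by simp, Or.inl rfl⟩
  · obtain ⟨b, hb, hmax⟩ := A.exists_max_image h hA
    rcases le_total 0 (h b) with h0 | h0
    · exact ⟨h b, h0, hmax, Or.inr ⟨b, hb, rfl⟩⟩
    · exact ⟨0, le_rfl, fun a ha => (hmax a ha).trans h0, Or.inl rfl⟩

variable {f g : ℝ → ℝ} {x : V → V → ℝ} {y : V → ℝ}

/-- The gain of `u` at its own deadline. -/
noncomputable def activeGain (I : FullyOnlineInstance V) (f g : ℝ → ℝ) (x : V → V → ℝ)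
    (y : V → ℝ) (p : List (OnlineEvent V)) (u : V) : ℝ :=
  ((run I.graph f g x y p).partner I.graph u (offers f g x y u)).elim 0 (offers f g x y u)

theorem activeGain_nonneg (hoff : ∀ u v, 0 ≤ offers f g x y u v) :
    0 ≤ activeGain I f g x y p u := by
  unfold activeGain
  cases (run I.graph f g x y p).partner I.graph u (offers f g x y u)
  · exact le_rfl
  · exact hoff _ _

theorem le_activeGain (hp : p ++ [.deadline u] <+: I.events) {w : V}
    (hu : u ∈ freeRun I.graph (offers f g x y) ∅ p)
    (hw : w ∈ freeRun I.graph (offers f g x y) ∅ p) (huw : I.graph.Adj u w) :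
    offers f g x y u w ≤ activeGain I f g x y p u := by
  classical
  unfold activeGain
  rw [partner_run hp, if_pos hu]
  have hmem : w ∈ (freeRun I.graph (offers f g x y) ∅ p).filter (I.graph.Adj u) :=
    Finset.mem_filter.2 ⟨hw, huw⟩
  rcases hb : bestOf (offers f g x y u)
    ((freeRun I.graph (offers f g x y) ∅ p).filter (I.graph.Adj u)) with _ | b
  · rw [bestOf_eq_none] at hb
    simp [hb] at hmem
  · exact (bestOf_spec hb).2 w hmem

/-- The case distinction for an edge `u v` where `u` has the earlier deadline: either `u` or `v` is
matched early, or the gain of `u` at its deadline is bounded below in terms of the best offer `σ`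
available in the absence of `u` and `v`. -/
theorem pair_cases (hcol : ∀ u v, I.graph.Adj u v → col u ≠ col v)
    (ho : ∀ u, Function.Injective (offers f g x y u)) (hoff : ∀ u v, 0 ≤ offers f g x y u v)
    (hp : p ++ [.deadline u] <+: I.events) (huv : I.graph.Adj u v)
    (hv : OnlineEvent.deadline v ∉ p) {σ : ℝ}
    (hσ : σ = 0 ∨ ∃ a ∈ freeRun I.graph (offers f g x y) {u, v} p, I.graph.Adj u a ∧
      σ = offers f g x y u a) :
    (Outbids I.graph (offers f g x y) {v} p u → (run I.graph f g x y p).IsMatched u) ∧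
    (Outbids I.graph (offers f g x y) {u} p v →
      (run I.graph f g x y (p ++ [.deadline u])).IsMatched v) ∧
    (¬ Outbids I.graph (offers f g x y) {v} p u → (run I.graph f g x y p).IsMatched u ∨
      σ ≤ activeGain I f g x y p u) ∧
    (¬ Outbids I.graph (offers f g x y) {v} p u → ¬ Outbids I.graph (offers f g x y) {u} p v →
      σ ≤ activeGain I f g x y p u ∧
      ((∀ a ∈ freeRun I.graph (offers f g x y) {u, v} p, I.graph.Adj u a →
        offers f g x y u a < offers f g x y u v) →
        (run I.graph f g x y (p ++ [.deadline u])).IsMatched v ∧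
        offers f g x y u v ≤ activeGain I f g x y p u)) := by
  classical
  have hp' := prefix_of_append hp
  have hu := notMem_of_prefix hp
  have hau := arrival_mem_of_prefix hp
  have hav := arrival_mem_of_adj hp huv
  have hc := hcol u v huv
  have hmv : (run I.graph f g x y p).IsMatched v →
      (run I.graph f g x y (p ++ [.deadline u])).IsMatched v := fun h => by
    rw [run_append_deadline, MatchState.isMatched_depart]
    exact Or.inl h
  have hactive : ¬ Outbids I.graph (offers f g x y) {v} p u →
      u ∈ freeRun I.graph (offers f g x y) ∅ p → σ ≤ activeGain I f g x y p u := by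
    intro hP hfree
    rcases hσ with rfl | ⟨a, ha, hua, rfl⟩
    · exact activeGain_nonneg hoff
    · exact le_activeGain hp hfree (mem_freeRun_of_not_outbids_pair ho hcol hc hp' hu hP ha hua) hua
  refine ⟨fun hP => ?_, fun hQ => hmv ?_, fun hP => ?_, fun hP hQ => ?_⟩
  · rw [isMatched_run_iff hp' hau hu]
    exact notMem_freeRun_of_outbids_pair ho hcol hc hp' hu hP
  · rw [isMatched_run_iff hp' hav hv]
    exact notMem_freeRun_of_outbids_pair ho hcol hc.symm hp' hv hQ
  -- Although it wins nothing in the absence of `v`, `u` may still be matched early through the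
  -- alternating path started by `v`. This alternative is the source of the minimum in `pair_bound`.
  · rw [isMatched_run_iff hp' hau hu]
    by_cases hfree : u ∈ freeRun I.graph (offers f g x y) ∅ p
    · exact Or.inr (hactive hP hfree)
    · exact Or.inl hfree
  · have key := mem_freeRun_iff_of_not_outbids_pair ho huv.ne hp' hu hv hau hav hP hQ
    have hufree := (key u).2 (Or.inl rfl)
    have hvfree := (key v).2 (Or.inr (Or.inl rfl))
    refine ⟨hactive hP hufree, fun hR => ⟨?_, le_activeGain hp hufree hvfree huv⟩⟩
    rw [run_append_deadline, MatchState.isMatched_depart]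
    refine Or.inr ⟨v, ?_, Or.inr rfl⟩
    rw [partner_run hp, if_pos hufree]
    refine bestOf_eq_some (ho u) (Finset.mem_filter.2 ⟨hvfree, huv⟩) fun a ha => ?_
    rw [Finset.mem_filter, key] at ha
    rcases ha with ⟨rfl | rfl | ha, hua⟩
    · exact absurd hua (I.graph.loopless.irrefl _)
    · exact le_rfl
    · exact (hR a ha hua).le

end BalancedRanking

/-! ### The law of the ranks: redrawing, absence of ties, measurability. -/

namespace BalancedRanking

open FullyOnlineInstance

theorem measurable_offers {V : Type*} {f g : ℝ → ℝ} {x : V → V → ℝ} (hg : Measurable g) (u v : V) :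
    Measurable fun y : V → ℝ => offers f g x y u v := by
  unfold offers
  fun_prop

variable {V : Type*} [Fintype V]

instance : IsProbabilityMeasure (rankMeasure V) := by
  unfold rankMeasure
  have : IsProbabilityMeasure (volume.restrict (Set.Icc (0 : ℝ) 1)) :=
    inferInstanceAs (IsProbabilityMeasure uniform)
  infer_instance

open Classical in
/-- Redrawing one rank does not change the law of the ranks. -/
theorem measurePreserving_update (u : V) :
    MeasurePreserving (fun p : (V → ℝ) × ℝ => Function.update p.1 u p.2)
      ((rankMeasure V).prod uniform) (rankMeasure V) := by
  have hm : Measurable fun p : (V → ℝ) × ℝ => Function.update p.1 u p.2 := by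
    rw [measurable_pi_iff]
    intro i
    by_cases h : i = u
    · subst h
      simpa using measurable_snd
    · simpa [h, Function.comp_def] using (measurable_pi_apply i).comp measurable_fst
  refine ⟨hm, ?_⟩
  refine (Measure.pi_eq fun s hs => ?_).symm
  rw [Measure.map_apply hm (MeasurableSet.univ_pi hs)]
  have : (fun p : (V → ℝ) × ℝ => Function.update p.1 u p.2) ⁻¹' Set.univ.pi s =
      (Set.univ.pi (Function.update s u Set.univ)) ×ˢ s u := by
    ext p
    simp only [Set.mem_preimage, Set.mem_pi, Set.mem_univ, true_imp_iff, Set.mem_prod]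
    constructor
    · refine fun h => ⟨fun i => ?_, by simpa using h u⟩
      by_cases hi : i = u
      · subst hi
        simp
      · simpa [hi] using h i
    · rintro ⟨h1, h2⟩ i
      by_cases hi : i = u
      · subst hi
        simpa using h2
      · simpa [hi] using h1 i
  rw [this, Measure.prod_prod, rankMeasure, Measure.pi_pi,
    ← Finset.mul_prod_erase Finset.univ _ (Finset.mem_univ u),
    ← Finset.mul_prod_erase Finset.univ (fun i => (volume.restrict (Set.Icc (0 : ℝ) 1)) (s i))
      (Finset.mem_univ u)]
  have h1 : (volume.restrict (Set.Icc (0 : ℝ) 1)) (Set.univ) = 1 :=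
    measure_univ (μ := uniform)
  rw [Function.update_self, h1, one_mul, mul_comm]
  congr 1
  refine Finset.prod_congr rfl fun i hi => ?_
  rw [Function.update_of_ne (Finset.ne_of_mem_erase hi)]

theorem ae_rank_mem : ∀ᵐ y ∂rankMeasure V, ∀ v, y v ∈ Set.Icc (0 : ℝ) 1 := by
  have : SigmaFinite (volume.restrict (Set.Icc (0 : ℝ) 1)) := inferInstance
  rw [ae_all_iff]
  intro v
  exact (Measure.tendsto_eval_ae_ae (μ := fun _ : V => volume.restrict (Set.Icc (0 : ℝ) 1))).eventually
    ae_uniform_mem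

variable {g : ℝ → ℝ}

/-- Redraw the rank of `a`: since `g` is strictly increasing, at most one value of it produces a tie
with the given offer of `b`. -/
theorem ae_offer_ne (hg : Measurable g) (hgm : StrictMonoOn g (Set.Icc 0 1)) {a b : V}
    (hab : a ≠ b) (c d : ℝ) : ∀ᵐ y ∂rankMeasure V, 1 - g (y a) - c ≠ 1 - g (y b) - d := by
  classical
  have hset : MeasurableSet {y : V → ℝ | 1 - g (y a) - c ≠ 1 - g (y b) - d} := by
    refine (measurableSet_eq_fun ?_ ?_).compl <;> fun_prop
  rw [← (measurePreserving_update a).map_eq,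
    ae_map_iff (measurePreserving_update a).measurable.aemeasurable hset]
  refine (Measure.ae_prod_iff_ae_ae ?_).2 (Filter.Eventually.of_forall fun y => ?_)
  · exact (measurePreserving_update a).measurable hset
  simp only [Function.update_self, Function.update_of_ne hab.symm]
  have hsub : {s | s ∈ Set.Icc (0 : ℝ) 1 ∧ 1 - g s - c = 1 - g (y b) - d}.Subsingleton := by
    rintro s ⟨hs, h⟩ t ⟨ht, h'⟩
    exact hgm.injOn hs ht (by linarith)
  have h0 : ∀ᵐ s ∂uniform,
      s ∉ {s | s ∈ Set.Icc (0 : ℝ) 1 ∧ 1 - g s - c = 1 - g (y b) - d} :=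
    measure_eq_zero_iff_ae_notMem.1 (hsub.measure_zero _)
  filter_upwards [h0, ae_uniform_mem] with s h hs heq
  exact h ⟨hs, heq⟩

/-- Ties have probability zero. -/
theorem ae_injective_offer (hg : Measurable g) (hgm : StrictMonoOn g (Set.Icc 0 1)) (c : V → ℝ) :
    ∀ᵐ y ∂rankMeasure V, Function.Injective fun v => 1 - g (y v) - c v := by
  have : ∀ᵐ y ∂rankMeasure V, ∀ a b : V, a ≠ b → 1 - g (y a) - c a ≠ 1 - g (y b) - c b := by
    rw [ae_all_iff]
    intro a
    rw [ae_all_iff]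
    intro b
    by_cases hab : a = b
    · exact Filter.Eventually.of_forall fun y h => absurd hab h
    · filter_upwards [ae_offer_ne hg hgm hab (c a) (c b)] with y hy _ using hy
  filter_upwards [this] with y hy a b h
  by_contra hab
  exact hy a b hab h

variable {G : SimpleGraph V} {f : ℝ → ℝ} {x : V → V → ℝ}

instance : Finite (MatchState V) := by
  refine Finite.of_injective (fun S : MatchState V => (S.present, S.matching)) ?_
  rintro ⟨a, b⟩ ⟨c, d⟩ h
  simpa using h

open Classical in
theorem measurableSet_bestOffers {S : MatchState V} {o : (V → ℝ) → V → ℝ}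
    (ho : ∀ v, Measurable fun y => o y v) (u : V) (Q : Finset V → Prop) :
    MeasurableSet {y | Q (S.bestOffers G u (o y))} := by
  have : {y | Q (S.bestOffers G u (o y))} =
      ⋃ B ∈ {B | Q B}, {y | S.bestOffers G u (o y) = B} := by
    ext y
    simp
  rw [this]
  refine MeasurableSet.biUnion (Set.to_countable _) fun B _ => ?_
  have : {y | S.bestOffers G u (o y) = B} =
      ⋂ v, {y | (v ∈ S.available G u ∧ ∀ w ∈ S.available G u, o y w ≤ o y v) ↔ v ∈ B} := by
    ext y
    simp [Finset.ext_iff, MatchState.bestOffers]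
  rw [this]
  refine MeasurableSet.iInter fun v => measurableSet_setOfPred.2 (Measurable.iff ?_ measurable_const)
  refine measurable_const.and (Measurable.forall fun w => Measurable.imp measurable_const ?_)
  exact measurableSet_setOfPred.1 (measurableSet_le (ho w) (ho v))

/-- There are finitely many states, so an event depending on the current state and the ranks is a
finite union over the states. -/
theorem measurableSet_of_state {R : (V → ℝ) → MatchState V}
    (hR : ∀ Q : MatchState V → Prop, MeasurableSet {y | Q (R y)})
    {Q : MatchState V → (V → ℝ) → Prop} (hQ : ∀ S, MeasurableSet {y | Q S y}) :
    MeasurableSet {y | Q (R y) y} := by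
  have : {y | Q (R y) y} = ⋃ S, {y | R y = S} ∩ {y | Q S y} := by
    ext y
    simp
  rw [this]
  exact MeasurableSet.iUnion fun S => (hR (· = S)).inter (hQ S)

theorem measurableSet_run (hg : Measurable g) (l : List (OnlineEvent V))
    (Q : MatchState V → Prop) : MeasurableSet {y | Q (run G f g x y l)} := by
  induction l using List.reverseRecOn generalizing Q with
  | nil =>
    change MeasurableSet {_y : V → ℝ | Q MatchState.init}
    exact MeasurableSet.const _
  | append_singleton l e ih =>
    simp only [run_append]
    rcases e with u | u
    · exact ih fun S => Q (S.arrive u)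
    · refine measurableSet_of_state (Q := fun S y => Q (step G f g x y S (.deadline u))) ih
        fun S => ?_
      classical
      exact measurableSet_bestOffers (S := S) (G := G) (measurable_offers hg u) u
        fun B => Q ⟨S.present.erase u,
          if h : ¬ S.IsMatched u ∧ B.Nonempty then insert s(u, h.2.choose) S.matching
          else S.matching⟩

theorem measurableSet_partner (hg : Measurable g) (l : List (OnlineEvent V)) (u : V)
    (Q : Option V → Prop) :
    MeasurableSet {y | Q ((run G f g x y l).partner G u (offers f g x y u))} := by
  refine measurableSet_of_state (Q := fun S y => Q (S.partner G u (offers f g x y u)))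
    (measurableSet_run hg l) fun S => ?_
  classical
  exact measurableSet_bestOffers (S := S) (G := G) (measurable_offers hg u) u
    fun B => Q (if S.IsMatched u then none else if h : B.Nonempty then some h.choose else none)

end BalancedRanking

/-! ### Existence and uniqueness of the lookahead water levels. -/

namespace BalancedRanking

open FullyOnlineInstance Filter Topology

variable {V : Type*} {G : SimpleGraph V} {f g : ℝ → ℝ} {x : V → V → ℝ} {y : V → ℝ}

theorem bestOf_eq_some_of_lt {o : V → ℝ} {A : Finset V} {b : V} (hb : b ∈ A)
    (hmax : ∀ w ∈ A, w ≠ b → o w < o b) : bestOf o A = some b := by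
  rcases h : bestOf o A with _ | c
  · rw [bestOf_eq_none] at h
    simp [h] at hb
  · have := bestOf_spec h
    by_contra hne
    exact absurd (this.2 b hb) (not_le.2 (hmax c this.1 fun e => hne (congrArg some e)))

theorem bestOf_eventually_eq {o : V → ℝ} (ho : Function.Injective o) {ι : Type*} {F : Filter ι}
    {o' : ι → V → ℝ} (h : ∀ a, Tendsto (fun i => o' i a) F (𝓝 (o a))) (A : Finset V) :
    ∀ᶠ i in F, bestOf (o' i) A = bestOf o A := by
  rcases hb : bestOf o A with _ | b
  · rw [bestOf_eq_none] at hb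
    exact Eventually.of_forall fun i => bestOf_eq_none.2 hb
  · have hs := bestOf_spec hb
    have hev : ∀ᶠ i in F, ∀ w ∈ A, w ≠ b → o' i w < o' i b := by
      rw [Filter.eventually_all_finset]
      intro w hw
      by_cases hwb : w = b
      · exact Eventually.of_forall fun _ h => absurd hwb h
      · have hlt : o w < o b := lt_of_le_of_ne (hs.2 w hw) fun e => hwb (ho e)
        filter_upwards [(h w).eventually_lt (h b) hlt] with i hi _ using hi
    filter_upwards [hev] with i hi using bestOf_eq_some_of_lt hs.1 hi

theorem partner_ne_none_iff {S : MatchState V} {u : V} {o : V → ℝ} :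
    S.partner G u o ≠ none ↔ ¬ S.IsMatched u ∧ S.available G u ≠ ∅ := by
  classical
  unfold MatchState.partner
  by_cases h : S.IsMatched u <;> simp [h, bestOf_eq_none]

theorem partner_eq_some_iff {S : MatchState V} {u w : V} {o : V → ℝ} (ho : Function.Injective o) :
    S.partner G u o = some w ↔ ¬ S.IsMatched u ∧ w ∈ S.available G u ∧
      ∀ a ∈ S.available G u, o a ≤ o w := by
  classical
  unfold MatchState.partner
  by_cases h : S.IsMatched u
  · simp [h]
  · simp only [h, if_false, not_false_eq_true, true_and]
    exact ⟨bestOf_spec, fun h => bestOf_eq_some ho h.1 h.2⟩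

theorem partner_spec {S : MatchState V} {u w : V} {o : V → ℝ} (h : S.partner G u o = some w) :
    ¬ S.IsMatched u ∧ w ∈ S.available G u ∧ ∀ a ∈ S.available G u, o a ≤ o w := by
  classical
  unfold MatchState.partner at h
  split_ifs at h with hu
  exact ⟨hu, bestOf_spec h⟩

/-- The probability that `v` is matched after the deadline of `u`, in a random state `R`, when the
levels `r` are used in the offers. -/
noncomputable def rowMap [Fintype V] (G : SimpleGraph V) (f g : ℝ → ℝ) (R : (V → ℝ) → MatchState V)
    (u : V) (r : V → ℝ) (v : V) : ℝ :=
  (rankMeasure V).real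
    {y | ((R y).depart G u fun v => 1 - g (y v) - f (r v)).IsMatched v}

section Row

variable [Fintype V] {R : (V → ℝ) → MatchState V}

theorem measurableSet_partner_row (hg : Measurable g)
    (hR : ∀ Q : MatchState V → Prop, MeasurableSet {y | Q (R y)}) (u : V) (r : V → ℝ)
    (Q : Option V → Prop) :
    MeasurableSet {y | Q ((R y).partner G u fun v => 1 - g (y v) - f (r v))} := by
  classical
  refine measurableSet_of_state
    (Q := fun S y => Q (S.partner G u fun v => 1 - g (y v) - f (r v))) hR fun S => ?_
  exact measurableSet_bestOffers (S := S) (G := G) (o := fun y v => 1 - g (y v) - f (r v))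
    (fun v => by fun_prop) u
    fun B => Q (if S.IsMatched u then none else if h : B.Nonempty then some h.choose else none)

theorem measurableSet_row (hg : Measurable g)
    (hR : ∀ Q : MatchState V → Prop, MeasurableSet {y | Q (R y)}) (u : V) (r : V → ℝ) (v : V) :
    MeasurableSet
      {y | ((R y).depart G u fun v => 1 - g (y v) - f (r v)).IsMatched v} := by
  simp only [MatchState.isMatched_depart, Set.ofPred_or]
  exact (hR fun S => S.IsMatched v).union
    (measurableSet_partner_row hg hR u r fun m => ∃ w, m = some w ∧ (v = u ∨ v = w))

/-- For almost all ranks there is no tie at the given levels, so the winner is locally constant in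
the levels; dominated convergence does the rest. -/
theorem continuous_rowMap (hg : Measurable g) (hgm : StrictMonoOn g (Set.Icc 0 1))
    (hf : Continuous f) (hR : ∀ Q : MatchState V → Prop, MeasurableSet {y | Q (R y)}) (u v : V) :
    Continuous fun r => rowMap G f g R u r v := by
  classical
  rw [continuous_iff_continuousAt]
  intro r₀
  have hind : ∀ r, rowMap G f g R u r v = ∫ y, Set.indicator
      {y | ((R y).depart G u fun v => 1 - g (y v) - f (r v)).IsMatched v}
      (fun _ => (1 : ℝ)) y ∂rankMeasure V := fun r => by
    rw [integral_indicator (measurableSet_row hg hR u r v)]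
    simp [rowMap]
  unfold ContinuousAt
  simp only [hind]
  refine tendsto_integral_filter_of_dominated_convergence (fun _ => 1) ?_ ?_ (integrable_const _) ?_
  · exact Eventually.of_forall fun r => (measurable_const.indicator
      (measurableSet_row hg hR u r v)).aestronglyMeasurable
  · refine Eventually.of_forall fun r => Eventually.of_forall fun y => ?_
    rw [Set.indicator_apply]
    split_ifs <;> simp
  · filter_upwards [ae_injective_offer hg hgm fun v => f (r₀ v)] with y hy
    refine tendsto_const_nhds.congr' ?_
    have hev := bestOf_eventually_eq hy (F := 𝓝 r₀) (o' := fun r v => 1 - g (y v) - f (r v))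
      (fun a => (Continuous.tendsto (by fun_prop) r₀)) ((R y).available G u)
    filter_upwards [hev] with r hr
    have : (R y).partner G u (fun v => 1 - g (y v) - f (r v)) =
        (R y).partner G u fun v => 1 - g (y v) - f (r₀ v) := by
      simp only [MatchState.partner, hr]
    simp only [Set.indicator_apply, Set.mem_ofPred_eq, MatchState.isMatched_depart, this]

/-- Raising the levels of other vertices can only raise the probability of being matched. -/
theorem rowMap_update_le (hg : Measurable g) (hgm : StrictMonoOn g (Set.Icc 0 1))
    (hf : Monotone f) [DecidableEq V] (u : V) (r : V → ℝ) {v w : V} (hwv : w ≠ v) {c : ℝ}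
    (hc : c ≤ r v) : rowMap G f g R u (Function.update r v c) w ≤ rowMap G f g R u r w := by
  classical
  unfold rowMap
  refine ENNReal.toReal_mono (measure_ne_top _ _) (measure_mono_ae ?_)
  filter_upwards [ae_injective_offer hg hgm fun v => f (r v)] with y hy h
  change MatchState.IsMatched _ _ at h
  change MatchState.IsMatched _ _
  rw [MatchState.isMatched_depart] at h ⊢
  rcases h with h | ⟨b, hb, rfl | rfl⟩
  · exact Or.inl h
  · have hn : (R y).partner G w (fun v => 1 - g (y v) - f (r v)) ≠ none :=
      partner_ne_none_iff.2 (partner_ne_none_iff.1 (by rw [hb]; simp))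
    obtain ⟨b', hb'⟩ := Option.ne_none_iff_exists'.1 hn
    exact Or.inr ⟨b', hb', Or.inl rfl⟩
  · refine Or.inr ⟨w, (partner_eq_some_iff hy).2 ?_, Or.inr rfl⟩
    obtain ⟨h1, h2, h3⟩ := partner_spec hb
    refine ⟨h1, h2, fun a ha => ?_⟩
    have := h3 a ha
    rw [Function.update_of_ne hwv] at this
    refine le_trans ?_ this
    by_cases hav : a = v
    · subst hav
      rw [Function.update_self]
      linarith [hf hc]
    · rw [Function.update_of_ne hav]

theorem rowMap_nonneg (u : V) (r : V → ℝ) (v : V) : 0 ≤ rowMap G f g R u r v :=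
  measureReal_nonneg

theorem rowMap_le_one (u : V) (r : V → ℝ) (v : V) : rowMap G f g R u r v ≤ 1 :=
  measureReal_le_one

/-- Among the points of the cube that dominate their image, take one with minimal coordinate sum. If
a coordinate strictly exceeded its image, it could be lowered a little: continuity keeps the
inequality there, and the images of the other coordinates do not increase. -/
theorem exists_row (hg : Measurable g) (hgm : StrictMonoOn g (Set.Icc 0 1))
    (hf : Continuous f) (hfm : Monotone f)
    (hR : ∀ Q : MatchState V → Prop, MeasurableSet {y | Q (R y)}) (u : V) :
    ∃ r : V → ℝ, ∀ v, r v = rowMap G f g R u r v := by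
  classical
  have hcont := continuous_rowMap (G := G) hg hgm hf hR u
  set K : Set (V → ℝ) := {r | ∀ v, rowMap G f g R u r v ≤ r v} ∩ Set.Icc 0 1 with hK
  have hcomp : IsCompact K := by
    refine isCompact_Icc.inter_left ?_
    rw [Set.ofPred_forall]
    exact isClosed_iInter fun v => isClosed_le (hcont v) (continuous_apply v)
  have hne : K.Nonempty :=
    ⟨1, fun v => rowMap_le_one u _ v, zero_le_one, le_rfl⟩
  obtain ⟨r, ⟨hr, hr01⟩, hmin⟩ := hcomp.exists_isMinOn hne
    (f := fun r : V → ℝ => ∑ v, r v) (by fun_prop)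
  refine ⟨r, fun v => (hr v).antisymm' ?_⟩
  by_contra! hlt
  have hup : Continuous fun c : ℝ => Function.update r v c := by fun_prop
  have hopen : ∀ᶠ c in 𝓝 (r v), rowMap G f g R u (Function.update r v c) v < c := by
    have h1 : Tendsto (fun c => rowMap G f g R u (Function.update r v c) v) (𝓝 (r v))
        (𝓝 (rowMap G f g R u r v)) := by
      have := ((hcont v).comp hup).tendsto (r v)
      simpa [Function.comp_def] using this
    exact h1.eventually_lt tendsto_id hlt
  obtain ⟨c, hc, hcv⟩ := ((hopen.filter_mono nhdsWithin_le_nhds).and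
    (self_mem_nhdsWithin (s := Set.Iio (r v)))).exists
  have hcv : c < r v := hcv
  have hmem : Function.update r v c ∈ K := by
    refine ⟨fun w => ?_, fun w => ?_, fun w => ?_⟩
    · by_cases hw : w = v
      · subst hw
        rw [Function.update_self]
        exact hc.le
      · rw [Function.update_of_ne hw]
        exact (rowMap_update_le hg hgm hfm u r hw hcv.le).trans (hr w)
    · by_cases hw : w = v
      · subst hw
        rw [Function.update_self]
        exact (rowMap_nonneg u _ w).trans hc.le
      · rw [Function.update_of_ne hw]
        exact hr01.1 w
    · by_cases hw : w = v
      · subst hw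
        rw [Function.update_self]
        exact hcv.le.trans (hr01.2 w)
      · rw [Function.update_of_ne hw]
        exact hr01.2 w
  have h1 : ∑ w, r w ≤ ∑ w, Function.update r v c w := hmin hmem
  refine absurd h1 (not_le.2 (Finset.sum_lt_sum (fun w _ => ?_) ⟨v, Finset.mem_univ v, by simpa⟩))
  by_cases hw : w = v
  · subst hw
    simpa using hcv.le
  · rw [Function.update_of_ne hw]

/-- Whether `u` gets matched at its deadline depends on the existence of an available neighbour, not
on the offers. -/
theorem rowMap_self (u : V) (r r' : V → ℝ) : rowMap G f g R u r u = rowMap G f g R u r' u := by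
  unfold rowMap
  congr 1
  ext y
  simp only [Set.mem_ofPred_eq, MatchState.isMatched_depart, true_or, and_true,
    ← Option.ne_none_iff_exists', partner_ne_none_iff]

theorem rowMap_of_ne (hg : Measurable g)
    (hR : ∀ Q : MatchState V → Prop, MeasurableSet {y | Q (R y)}) {u v : V} (hvu : v ≠ u)
    (r : V → ℝ) : rowMap G f g R u r v = (rankMeasure V).real {y | (R y).IsMatched v} +
      (rankMeasure V).real {y | (R y).partner G u (fun v => 1 - g (y v) - f (r v)) = some v} := by
  rw [rowMap, ← measureReal_union ?_ (measurableSet_partner_row hg hR u r (· = some v))]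
  · congr 1
    ext y
    simp [MatchState.isMatched_depart, hvu]
  · refine Set.disjoint_left.2 fun y h1 h2 => ?_
    exact (MatchState.partner_eq_some h2).2.2.2 h1

/-- Let `A` be the set of vertices other than `u` whose level is larger in `r` than in `r'`. Passing
from `r` to `r'` raises no offer outside `A` among the neighbours and lowers none inside, so a
partner in `A` is replaced by one in `A`. Hence the total matching probability of `A` does not
decrease, contrary to the choice of `A` if it is nonempty. -/
theorem row_le_of_fixed (hg : Measurable g) (hgm : StrictMonoOn g (Set.Icc 0 1))
    (hfm : Monotone f) (hR : ∀ Q : MatchState V → Prop, MeasurableSet {y | Q (R y)}) {u : V}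
    {r r' : V → ℝ} (hr : ∀ v, r v = rowMap G f g R u r v)
    (hr' : ∀ v, r' v = rowMap G f g R u r' v) : r ≤ r' := by
  classical
  set A : Finset V := Finset.univ.filter fun v => v ≠ u ∧ r' v < r v with hA
  have hsum : ∀ s : V → ℝ, ∑ v ∈ A, (rankMeasure V).real
      {y | (R y).partner G u (fun v => 1 - g (y v) - f (s v)) = some v} =
      (rankMeasure V).real
        (⋃ v ∈ A, {y | (R y).partner G u (fun v => 1 - g (y v) - f (s v)) = some v}) := by
    intro s
    refine (measureReal_biUnion_finset ?_ fun v _ =>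
      measurableSet_partner_row hg hR u s (· = some v)).symm
    intro a _ b _ hab
    refine Set.disjoint_left.2 fun y h1 h2 => hab ?_
    simp only [Set.mem_ofPred_eq] at h1 h2
    exact Option.some.inj (h1.symm.trans h2)
  have hle : ∑ v ∈ A, (rankMeasure V).real
      {y | (R y).partner G u (fun v => 1 - g (y v) - f (r v)) = some v} ≤
      ∑ v ∈ A, (rankMeasure V).real
      {y | (R y).partner G u (fun v => 1 - g (y v) - f (r' v)) = some v} := by
    rw [hsum, hsum]
    refine ENNReal.toReal_mono (measure_ne_top _ _) (measure_mono_ae ?_)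
    filter_upwards [ae_injective_offer hg hgm fun v => f (r' v)] with y hy h
    obtain ⟨a, haA, ha⟩ := Set.mem_iUnion₂.1 h
    replace ha : (R y).partner G u (fun v => 1 - g (y v) - f (r v)) = some a := ha
    have hn : (R y).partner G u (fun v => 1 - g (y v) - f (r' v)) ≠ none :=
      partner_ne_none_iff.2 (partner_ne_none_iff.1 (by rw [ha]; simp))
    obtain ⟨b, hb⟩ := Option.ne_none_iff_exists'.1 hn
    refine Set.mem_iUnion₂.2 ⟨b, ?_, hb⟩
    by_contra hbA
    obtain ⟨-, ha2, ha3⟩ := partner_spec ha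
    obtain ⟨-, hb2, hb3⟩ := partner_spec hb
    have hbu : b ≠ u := (MatchState.partner_eq_some hb).2.1.ne'
    have hrb : r b ≤ r' b := by
      by_contra! hlt
      exact hbA (by simp [hA, hbu, hlt])
    have hra : r' a < r a := by
      simp only [hA, Finset.mem_filter] at haA
      exact haA.2.2
    have e : a = b := hy (le_antisymm (hb3 a ha2) (by
      have := ha3 b hb2
      have h1 := hfm hrb
      have h2 := hfm hra.le
      simp only at this ⊢
      linarith))
    exact hbA (e ▸ haA)
  intro v
  by_cases hvu : v = u
  · subst hvu
    rw [hr v, hr' v, rowMap_self]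
  by_contra! hlt
  have hvA : v ∈ A := by simp [hA, hvu, hlt]
  have hlt' : ∑ v ∈ A, r' v < ∑ v ∈ A, r v := by
    refine Finset.sum_lt_sum (fun w hw => ?_) ⟨v, hvA, hlt⟩
    simp only [hA, Finset.mem_filter] at hw
    exact hw.2.2.le
  have heq : ∀ s : V → ℝ, (∀ v, s v = rowMap G f g R u s v) → ∑ v ∈ A, s v =
      ∑ v ∈ A, (rankMeasure V).real {y | (R y).IsMatched v} + ∑ v ∈ A, (rankMeasure V).real
      {y | (R y).partner G u (fun v => 1 - g (y v) - f (s v)) = some v} := by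
    intro s hs
    rw [← Finset.sum_add_distrib]
    refine Finset.sum_congr rfl fun w hw => ?_
    simp only [hA, Finset.mem_filter] at hw
    rw [hs w, rowMap_of_ne hg hR hw.2.1]
  rw [heq r hr, heq r' hr'] at hlt'
  linarith

end Row

theorem run_congr {x x' : V → V → ℝ} {l : List (OnlineEvent V)}
    (h : ∀ u, OnlineEvent.deadline u ∈ l → x u = x' u) :
    run G f g x y l = run G f g x' y l := by
  induction l using List.reverseRecOn with
  | nil => rfl
  | append_singleton l e ih =>
    rw [run_append, run_append, ih fun u hu => h u (List.mem_append_left _ hu)]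
    rcases e with u | u
    · rfl
    · simp only [step, h u (by simp)]

variable [Fintype V] {I : FullyOnlineInstance V}

theorem isLookahead_row {x : V → V → ℝ} (hx : IsLookahead f g I x) {p : List (OnlineEvent V)}
    {u : V} (hp : p ++ [.deadline u] <+: I.events) (v : V) :
    x u v = (rankMeasure V).real
      {y | (run I.graph f g x y (p ++ [.deadline u])).IsMatched v} := by
  obtain ⟨q, hq⟩ := hp
  exact hx u p q (by rw [← hq]; simp) v

theorem isLookahead_rowMap {x : V → V → ℝ} (hx : IsLookahead f g I x) {p : List (OnlineEvent V)}
    {u : V} (hp : p ++ [.deadline u] <+: I.events) (v : V) :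
    x u v = rowMap I.graph f g (fun y => run I.graph f g x y p) u (x u) v := by
  rw [isLookahead_row hx hp v]
  simp only [run_append_deadline]
  rfl

/-- By induction along the events the random state before each deadline is the same, so the two new
rows are fixed points of the same map. -/
theorem isLookahead_unique (hg : Measurable g) (hgm : StrictMonoOn g (Set.Icc 0 1))
    (hfm : Monotone f) {x x' : V → V → ℝ} (hx : IsLookahead f g I x)
    (hx' : IsLookahead f g I x') : x = x' := by
  have key := prefix_induction (I := I)
    (motive := fun p => ∀ u, OnlineEvent.deadline u ∈ p → x u = x' u) (by simp) ?_
    I.events (List.prefix_refl _)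
  · exact funext fun u => key u (I.complete _)
  · intro p e hp ih u hu
    rcases List.mem_append.1 hu with hu | hu
    · exact ih u hu
    · rw [List.mem_singleton] at hu
      subst hu
      have h1 := isLookahead_rowMap hx hp
      have h2 := isLookahead_rowMap hx' hp
      simp only [← run_congr (fun u hu => ih u hu)] at h2
      have hR := measurableSet_run (G := I.graph) (f := f) (x := x) hg p
      exact le_antisymm (row_le_of_fixed hg hgm hfm hR h1 h2)
        (row_le_of_fixed hg hgm hfm hR h2 h1)

theorem exists_isLookahead (hg : Measurable g) (hgm : StrictMonoOn g (Set.Icc 0 1))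
    (hf : Continuous f) (hfm : Monotone f) : ∃ x, IsLookahead f g I x := by
  classical
  have key := prefix_induction (I := I)
    (motive := fun p => ∃ x : V → V → ℝ, ∀ u q, q ++ [.deadline u] <+: p → ∀ v,
      x u v = (rankMeasure V).real
        {y | (run I.graph f g x y (q ++ [.deadline u])).IsMatched v}) ?_ ?_
    I.events (List.prefix_refl _)
  · obtain ⟨x, hx⟩ := key
    exact ⟨x, fun u q s h => hx u q ⟨s, by rw [h]; simp⟩⟩
  · exact ⟨fun _ _ => 0, fun u q h => by simpa using List.prefix_nil.1 h⟩
  · rintro p e hp ⟨x, hx⟩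
    rcases e with a | a
    · refine ⟨x, fun u q h => hx u q ?_⟩
      rcases List.prefix_concat_iff.1 h with h | h
      · have := (List.append_inj' h rfl).2
        simp at this
      · exact h
    · obtain ⟨r, hr⟩ := exists_row (G := I.graph) hg hgm hf hfm
        (measurableSet_run (G := I.graph) (f := f) (x := x) hg p) a
      have hcongr : ∀ q, q <+: p → ∀ y, run I.graph f g (Function.update x a r) y q =
          run I.graph f g x y q := fun q hq y => run_congr fun u hu => by
        rw [Function.update_of_ne]
        rintro rfl
        exact notMem_of_prefix hp (hq.subset hu)
      refine ⟨Function.update x a r, fun u q h v => ?_⟩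
      rcases List.prefix_concat_iff.1 h with h' | h'
      · obtain ⟨rfl, h'⟩ := List.append_inj' h' rfl
        obtain rfl : u = a := by simpa using h'
        rw [Function.update_self, hr v, rowMap]
        simp only [run_append_deadline, hcongr q (List.prefix_refl q)]
        unfold offers
        simp only [Function.update_self]
      · rw [Function.update_of_ne, hx u q h' v]
        · simp only [hcongr _ h']
        · rintro rfl
          exact notMem_of_prefix hp
            (h'.subset (List.mem_append_right q (List.mem_singleton_self _)))

end BalancedRanking

/-! ### The history before a given deadline. -/

namespace FullyOnlineInstance

variable {V : Type*} (I : FullyOnlineInstance V)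

theorem exists_prefix_deadline (u : V) :
    ∃ p, p ++ [OnlineEvent.deadline u] <+: I.events := by
  obtain ⟨p, q, h⟩ := List.append_of_mem (I.complete (.deadline u))
  exact ⟨p, q, by rw [h]; simp⟩

/-- The events before the deadline of `u`. -/
noncomputable def before (u : V) : List (OnlineEvent V) := (I.exists_prefix_deadline u).choose

theorem before_spec (u : V) : I.before u ++ [OnlineEvent.deadline u] <+: I.events :=
  (I.exists_prefix_deadline u).choose_spec

variable {I}

theorem deadline_mem_of_prefix_ne {p q : List (OnlineEvent V)} {u : V}
    (h : p ++ [OnlineEvent.deadline u] <+: q ++ [OnlineEvent.deadline u]) :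
    p = q ∨ OnlineEvent.deadline u ∈ q := by
  rcases List.prefix_concat_iff.1 h with h | h
  · exact Or.inl (List.append_inj' h rfl).1
  · exact Or.inr (h.subset (List.mem_append_right p (List.mem_singleton_self _)))

theorem eq_before {p : List (OnlineEvent V)} {u : V}
    (hp : p ++ [OnlineEvent.deadline u] <+: I.events) : p = I.before u := by
  rcases List.prefix_or_prefix_of_prefix hp (I.before_spec u) with h | h
  · exact (deadline_mem_of_prefix_ne h).resolve_right (notMem_of_prefix (I.before_spec u))
  · exact ((deadline_mem_of_prefix_ne h).resolve_right (notMem_of_prefix hp)).symm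

theorem deadline_notMem_before (I : FullyOnlineInstance V) (u v : V) :
    OnlineEvent.deadline v ∉ I.before u ∨ OnlineEvent.deadline u ∉ I.before v := by
  by_contra! h
  have key : ∀ u v, OnlineEvent.deadline v ∈ I.before u →
      (I.before v).length < (I.before u).length := fun u v h => by
    obtain ⟨p, q, hpq⟩ := List.append_of_mem h
    have hp : p ++ [OnlineEvent.deadline v] <+: I.events :=
      List.IsPrefix.trans ⟨q ++ [OnlineEvent.deadline u], by simp [hpq]⟩ (I.before_spec u)
    rw [← eq_before hp, hpq]
    simp
  exact lt_asymm (key u v h.1) (key v u h.2)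

end FullyOnlineInstance

/-! ### Gains: splitting matched edges and accounting for the water levels. -/

namespace BalancedRanking

open FullyOnlineInstance

variable {V : Type*} {I : FullyOnlineInstance V} {f g : ℝ → ℝ} {x : V → V → ℝ}
  {y : V → ℝ} {p : List (OnlineEvent V)}

/-- The vertex to which `z` is matched at its own deadline, if any. -/
noncomputable def chosen (I : FullyOnlineInstance V) (f g : ℝ → ℝ) (x : V → V → ℝ) (y : V → ℝ)
    (z : V) : Option V :=
  (run I.graph f g x y (I.before z)).partner I.graph z (offers f g x y z)

theorem isMatched_run_append_deadline {u w : V} (hp : p ++ [.deadline u] <+: I.events)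
    (hwu : w ≠ u) : (run I.graph f g x y (p ++ [.deadline u])).IsMatched w ↔
      (run I.graph f g x y p).IsMatched w ∨ chosen I f g x y u = some w := by
  rw [run_append_deadline, MatchState.isMatched_depart, chosen, ← eq_before hp]
  simp [hwu]

theorem not_isMatched_of_chosen {u w : V} (hp : p ++ [.deadline u] <+: I.events)
    (h : chosen I f g x y u = some w) : ¬ (run I.graph f g x y p).IsMatched w := by
  rw [chosen, ← eq_before hp] at h
  exact (MatchState.partner_eq_some h).2.2.2

variable [Fintype V]

open Classical in
/-- The vertices whose deadline is in `p`. -/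
noncomputable def expired (p : List (OnlineEvent V)) : Finset V :=
  Finset.univ.filter fun z => OnlineEvent.deadline z ∈ p

theorem mem_expired {z : V} : z ∈ expired p ↔ OnlineEvent.deadline z ∈ p := by
  simp [expired]

theorem expired_append_arrival (u : V) : expired (p ++ [.arrival u]) = expired p := by
  ext z
  simp [mem_expired]

open Classical in
theorem expired_append_deadline (u : V) :
    expired (p ++ [.deadline u]) = insert u (expired p) := by
  ext z
  simp [mem_expired, or_comm]

theorem card_matching_run (hp : p <+: I.events) :
    (run I.graph f g x y p).matching.card =
      ∑ z ∈ expired p, (chosen I f g x y z).elim 0 fun _ => 1 := by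
  classical
  revert hp
  refine prefix_induction (I := I) (motive := fun p => (run I.graph f g x y p).matching.card =
      ∑ z ∈ expired p, (chosen I f g x y z).elim 0 fun _ => 1) ?_ ?_ p
  · simp [run, MatchState.init, expired]
  · intro p e hp ih
    rcases e with u | u
    · rw [expired_append_arrival, ← ih, run_append]
      rfl
    · rw [expired_append_deadline, Finset.sum_insert
        (by rw [mem_expired]; exact notMem_of_prefix hp), ← ih, run_append_deadline,
        MatchState.depart_matching]
      have hp' := eq_before hp
      unfold chosen
      rw [← hp']
      rcases hb : (run I.graph f g x y p).partner I.graph u (offers f g x y u) with _ | w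
      · simp
      · simp only [Option.elim_some]
        rw [Finset.card_insert_of_notMem, add_comm]
        intro hmem
        exact (MatchState.partner_eq_some hb).1 ⟨_, hmem, Sym2.mem_mk_left u w⟩

-- Before its own deadline a vertex can be matched only by being chosen, and this happens at most
-- once.
open Classical in
theorem indicator_isMatched_run {w : V} (hp : p <+: I.events) (hw : OnlineEvent.deadline w ∉ p)
    (c : ℝ) : (if (run I.graph f g x y p).IsMatched w then c else 0) =
      ∑ z ∈ expired p, if chosen I f g x y z = some w then c else 0 := by
  revert hp hw
  refine prefix_induction (I := I) (motive := fun p => OnlineEvent.deadline w ∉ p →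
    (if (run I.graph f g x y p).IsMatched w then c else 0) =
      ∑ z ∈ expired p, if chosen I f g x y z = some w then c else 0) ?_ ?_ p
  · simp [run, MatchState.init, MatchState.IsMatched, expired]
  · intro p e hp ih hw
    have hw' : OnlineEvent.deadline w ∉ p := fun h => hw (List.mem_append_left _ h)
    rcases e with u | u
    · rw [expired_append_arrival, ← ih hw']
      simp only [isMatched_run_arrival]
    · have hwu : w ≠ u := by
        rintro rfl
        simp at hw
      rw [expired_append_deadline, Finset.sum_insert
        (by rw [mem_expired]; exact notMem_of_prefix hp), ← ih hw']
      simp only [isMatched_run_append_deadline hp hwu]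
      by_cases h : chosen I f g x y u = some w
      · simp [h, not_isMatched_of_chosen hp h]
      · simp [h]

theorem measurableSet_chosen (hg : Measurable g) (z : V) (m : Option V) :
    MeasurableSet {y | chosen I f g x y z = m} :=
  measurableSet_partner hg (I.before z) z (· = m)

theorem integral_ite_const {Q : (V → ℝ) → Prop} [DecidablePred Q] (hQ : MeasurableSet {y | Q y}) (c : ℝ) :
    ∫ y, (if Q y then c else 0) ∂rankMeasure V = (rankMeasure V).real {y | Q y} * c := by
  have : (fun y => if Q y then c else 0) = Set.indicator {y | Q y} fun _ => c := by
    ext y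
    simp [Set.indicator_apply]
  rw [this, integral_indicator hQ]
  simp

theorem integrable_ite {Q : (V → ℝ) → Prop} [DecidablePred Q] (hQ : MeasurableSet {y | Q y}) {h : (V → ℝ) → ℝ}
    (hh : Integrable h (rankMeasure V)) :
    Integrable (fun y => if Q y then h y else 0) (rankMeasure V) := by
  have : (fun y => if Q y then h y else 0) = Set.indicator {y | Q y} h := by
    ext y
    simp [Set.indicator_apply]
  rw [this]
  exact hh.indicator hQ

open Classical in
/-- The part of the passive gain of `w` that comes from the water levels, until `p`. -/
noncomputable def levelGain (I : FullyOnlineInstance V) (f g : ℝ → ℝ) (x : V → V → ℝ)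
    (y : V → ℝ) (p : List (OnlineEvent V)) (w : V) : ℝ :=
  ∑ z ∈ expired p, if chosen I f g x y z = some w then f (x z w) else 0

theorem integrable_levelGain (hg : Measurable g) (w : V) :
    Integrable (fun y => levelGain I f g x y p w) (rankMeasure V) := by
  classical
  exact integrable_finsetSum _ fun z _ =>
    integrable_ite (measurableSet_chosen hg z _) (integrable_const _)

/-- The expected gain from the water levels is at least the primitive of `f` at the probability
of being matched. -/
theorem waterPrimitive_le_integral_levelGain (hg : Measurable g)
    (hx : IsLookahead waterWeight g I x) {w : V} (hp : p <+: I.events)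
    (hw : OnlineEvent.deadline w ∉ p) :
    waterPrimitive ((rankMeasure V).real {y | (run I.graph waterWeight g x y p).IsMatched w}) ≤
      ∫ y, levelGain I waterWeight g x y p w ∂rankMeasure V := by
  classical
  revert hp hw
  refine prefix_induction (I := I) (motive := fun p => OnlineEvent.deadline w ∉ p →
    waterPrimitive ((rankMeasure V).real {y | (run I.graph waterWeight g x y p).IsMatched w}) ≤
      ∫ y, levelGain I waterWeight g x y p w ∂rankMeasure V) ?_ ?_ p
  · simp [run, MatchState.init, MatchState.IsMatched, expired, levelGain, waterPrimitive]
    norm_num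
  · intro p e hp ih hw
    have ih := ih fun h => hw (List.mem_append_left _ h)
    rcases e with u | u
    · simp only [levelGain, expired_append_arrival, isMatched_run_arrival]
      exact ih
    · have hwu : w ≠ u := by
        rintro rfl
        simp at hw
      have hsplit : (rankMeasure V).real
          {y | (run I.graph waterWeight g x y (p ++ [.deadline u])).IsMatched w} =
          (rankMeasure V).real {y | (run I.graph waterWeight g x y p).IsMatched w} +
          (rankMeasure V).real {y | chosen I waterWeight g x y u = some w} := by
        rw [← measureReal_union _ (measurableSet_chosen hg u _)]
        · congr 1
          ext y
          exact isMatched_run_append_deadline hp hwu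
        · exact Set.disjoint_left.2 fun y h1 h2 => not_isMatched_of_chosen hp h2 h1
      have hxu := isLookahead_row hx hp w
      -- The fixed-point equation makes `x u w` exactly the matching probability after this step, so
      -- the increment of the probability is weighted by `f` at its right endpoint.
      have hstep := waterPrimitive_step
        (w := (rankMeasure V).real {y | (run I.graph waterWeight g x y p).IsMatched w})
        (x := x u w) (by rw [hxu, hsplit]; exact le_add_of_nonneg_right measureReal_nonneg)
      have hint : ∫ y, levelGain I waterWeight g x y (p ++ [.deadline u]) w ∂rankMeasure V =
          (rankMeasure V).real {y | chosen I waterWeight g x y u = some w} *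
            waterWeight (x u w) + ∫ y, levelGain I waterWeight g x y p w ∂rankMeasure V := by
        rw [← integral_ite_const (measurableSet_chosen hg u _),
          ← integral_add (integrable_ite (measurableSet_chosen hg u _) (integrable_const _))
            (integrable_levelGain hg w)]
        unfold levelGain
        congr 1
        ext y
        rw [expired_append_deadline, Finset.sum_insert
          (by rw [mem_expired]; exact notMem_of_prefix hp)]
      rw [hint, ← hxu]
      have : x u w - (rankMeasure V).real {y | (run I.graph waterWeight g x y p).IsMatched w} =
          (rankMeasure V).real {y | chosen I waterWeight g x y u = some w} := by
        rw [hxu, hsplit]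
        ring
      rw [this] at hstep
      linarith

open Classical in
/-- The gain of `w` in the primal-dual analysis. -/
noncomputable def gain (I : FullyOnlineInstance V) (f g : ℝ → ℝ) (x : V → V → ℝ) (y : V → ℝ)
    (w : V) : ℝ :=
  activeGain I f g x y (I.before w) w +
    ∑ z, if chosen I f g x y z = some w then g (y w) + f (x z w) else 0

/-- Every matched edge is charged to the endpoint that departed, and the offer together with the
share of the chosen vertex is 1. -/
theorem sum_gain : ∑ w, gain I f g x y w = ((run I.graph f g x y I.events).matching.card : ℝ) := by
  classical
  have huniv : expired I.events = Finset.univ := by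
    ext z
    simp [mem_expired, I.complete]
  rw [card_matching_run (List.prefix_refl _), huniv]
  unfold gain
  rw [Finset.sum_add_distrib, Finset.sum_comm, ← Finset.sum_add_distrib]
  push_cast
  refine Finset.sum_congr rfl fun z _ => ?_
  change (chosen I f g x y z).elim 0 (offers f g x y z) + _ = _
  rcases chosen I f g x y z with _ | w
  · simp
  · simp [offers]

theorem activeGain_eq_sum [DecidableEq V] (u : V) :
    activeGain I f g x y (I.before u) u =
      ∑ w, if chosen I f g x y u = some w then offers f g x y u w else 0 := by
  change (chosen I f g x y u).elim 0 (offers f g x y u) = _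
  rcases chosen I f g x y u with _ | w <;> simp

theorem gain_lower (hf : ∀ u v, 0 ≤ f (x u v))
    {w : V} (hgy : 0 ≤ g (y w)) (hp : p <+: I.events) (hw : OnlineEvent.deadline w ∉ p) :
    (open Classical in if (run I.graph f g x y p).IsMatched w then g (y w) else 0) +
      levelGain I f g x y p w + activeGain I f g x y (I.before w) w ≤ gain I f g x y w := by
  classical
  rw [indicator_isMatched_run hp hw, levelGain, ← Finset.sum_add_distrib, gain, add_comm]
  refine add_le_add_right ?_ _
  refine le_trans (Finset.sum_le_sum fun z _ => ?_)
    (Finset.sum_le_sum_of_subset_of_nonneg (Finset.subset_univ (expired p)) fun z _ _ => ?_)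
  · split_ifs <;> simp
  · split_ifs
    · exact add_nonneg hgy (hf _ _)
    · exact le_rfl

theorem gain_nonneg (hoff : ∀ u v, 0 ≤ offers f g x y u v) (hf : ∀ u v, 0 ≤ f (x u v))
    {w : V} (hgy : 0 ≤ g (y w)) : 0 ≤ gain I f g x y w := by
  classical
  refine add_nonneg (activeGain_nonneg hoff) (Finset.sum_nonneg fun z _ => ?_)
  split_ifs
  · exact add_nonneg hgy (hf _ _)
  · exact le_rfl

end BalancedRanking

/-! ### The expected gain of an edge and weak duality. -/

namespace BalancedRanking

open FullyOnlineInstance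

variable {V : Type*} {I : FullyOnlineInstance V} {x : V → V → ℝ}

/-- The ranks are in `[0, 1]` and there are no ties. -/
def Generic (x : V → V → ℝ) (y : V → ℝ) : Prop :=
  (∀ v, y v ∈ Set.Icc (0 : ℝ) 1) ∧ ∀ u, Function.Injective (offers waterWeight rankWeight x y u)

theorem rankWeight_strictMonoOn_Icc : StrictMonoOn rankWeight (Set.Icc 0 1) :=
  rankWeight_strictMonoOn.mono Set.Icc_subset_Ici_self

theorem rankWeight_mem {t : ℝ} (ht : t ∈ Set.Icc (0 : ℝ) 1) :
    1 / 25 ≤ rankWeight t ∧ rankWeight t ≤ 907 / 1000 := by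
  have h1 := gainSlope_lower ht.1
  have h2 := gainSlope_upper ht.1 ht.2
  unfold rankWeight
  constructor <;> linarith

theorem Generic.offers_nonneg {y : V → ℝ} (hy : Generic x y) (u v : V) :
    0 ≤ offers waterWeight rankWeight x y u v := by
  have h1 := (rankWeight_mem (hy.1 v)).2
  have h2 := waterWeight_le (x u v)
  unfold offers
  linarith

theorem offers_update_of_ne [DecidableEq V] {f g : ℝ → ℝ} {y : V → ℝ} {u a : V} (s : ℝ) (z : V)
    (h : a ≠ u) : offers f g x (Function.update y u s) z a = offers f g x y z a := by
  simp [offers, h]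

theorem offers_update_self [DecidableEq V] {f g : ℝ → ℝ} {y : V → ℝ} {u : V} (s : ℝ) (z : V) :
    offers f g x (Function.update y u s) z u = 1 - g s - f (x z u) := by
  simp [offers]

theorem outbids_update_mono [DecidableEq V] {y : V → ℝ} {K : Set V} {p : List (OnlineEvent V)}
    {u : V} {s s' : ℝ} (hs : s ∈ Set.Icc (0 : ℝ) 1) (hs' : s' ∈ Set.Icc (0 : ℝ) 1) (hss : s ≤ s')
    (h : Outbids I.graph (offers waterWeight rankWeight x (Function.update y u s')) K p u) :
    Outbids I.graph (offers waterWeight rankWeight x (Function.update y u s)) K p u := by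
  refine h.congr (fun z a ha => ?_) fun z => ?_
  · have hau : a ≠ u := fun e => ha (Or.inl e)
    rw [offers_update_of_ne _ _ hau, offers_update_of_ne _ _ hau]
  · rw [offers_update_self, offers_update_self]
    have := rankWeight_strictMonoOn_Icc.monotoneOn hs hs' hss
    linarith

open Classical in
/-- The part of the gain of `u` and `v` that is bounded for every value of the other ranks. -/
noncomputable def pairGain (I : FullyOnlineInstance V) (x : V → V → ℝ) (u v : V) (y : V → ℝ) :
    ℝ :=
  (if (run I.graph waterWeight rankWeight x y (I.before u)).IsMatched u
    then rankWeight (y u) + 1 / 25 else 0) +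
  activeGain I waterWeight rankWeight x y (I.before u) u +
  (if (run I.graph waterWeight rankWeight x y (I.before u ++ [.deadline u])).IsMatched v
    then rankWeight (y v) - 1 / 25 else 0)

/-- All contests are evaluated in the run without `u` and `v`, whose course and best alternative
offer σ depend on neither of the two ranks. Therefore early winning of `u` is a condition on its own
rank alone, likewise for `v`, and `pair_bound` applies with σ held fixed. -/
theorem pairGain_bound [DecidableEq V] {col : V → Bool}
    (hcol : ∀ u v, I.graph.Adj u v → col u ≠ col v) {u v : V} (huv : I.graph.Adj u v)
    (hv : OnlineEvent.deadline v ∉ I.before u) (hb : 0 ≤ x u v) (y : V → ℝ)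
    (hint : Integrable (fun q : ℝ × ℝ =>
      pairGain I x u v (Function.update (Function.update y u q.1) v q.2)) (uniform.prod uniform))
    (hgen : ∀ᵐ q ∂uniform.prod uniform,
      Generic x (Function.update (Function.update y u q.1) v q.2)) :
    569 / 1000 ≤ (∫ q, pairGain I x u v (Function.update (Function.update y u q.1) v q.2)
      ∂uniform.prod uniform) + (waterPrimitive (x u v) + x u v / 25 - 1 / 125) := by
  classical
  set p := I.before u with hp
  set o := offers waterWeight rankWeight x y with ho
  have huv' : u ≠ v := huv.ne
  obtain ⟨σ, hσ0, hσle, hσ⟩ := exists_nonneg_best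
    ((freeRun I.graph o {u, v} p).filter (I.graph.Adj u)) (o u)
  have hoff : ∀ (s t : ℝ) (z a : V), a ∉ ({u, v} : Set V) →
      o z a = offers waterWeight rankWeight x (Function.update (Function.update y u s) v t) z a := by
    intro s t z a ha
    rw [offers_update_of_ne _ _ fun e => ha (Or.inr e), offers_update_of_ne _ _ fun e => ha (Or.inl e)]
  have hfree : ∀ s t : ℝ, freeRun I.graph
      (offers waterWeight rankWeight x (Function.update (Function.update y u s) v t)) {u, v} p =
      freeRun I.graph o {u, v} p := fun s t => (freeRun_congr (hoff s t) p).symm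
  have hPiff : ∀ s t : ℝ, Outbids I.graph
      (offers waterWeight rankWeight x (Function.update (Function.update y u s) v t)) {v} p u ↔
      Outbids I.graph (offers waterWeight rankWeight x (Function.update y u s)) {v} p u := by
    intro s t
    have hu : ∀ z, offers waterWeight rankWeight x
        (Function.update (Function.update y u s) v t) z u =
        offers waterWeight rankWeight x (Function.update y u s) z u :=
      fun z => offers_update_of_ne _ _ huv'
    have ha : ∀ z, ∀ a ∉ insert u ({v} : Set V), offers waterWeight rankWeight x
        (Function.update (Function.update y u s) v t) z a =
        offers waterWeight rankWeight x (Function.update y u s) z a :=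
      fun z a ha => offers_update_of_ne _ _ fun e => ha (Or.inr e)
    exact ⟨fun h => h.congr ha fun z => (hu z).le,
      fun h => h.congr (fun z a h => (ha z a h).symm) fun z => (hu z).ge⟩
  have hQiff : ∀ s t : ℝ, Outbids I.graph
      (offers waterWeight rankWeight x (Function.update (Function.update y u s) v t)) {u} p v ↔
      Outbids I.graph (offers waterWeight rankWeight x (Function.update y v t)) {u} p v := by
    intro s t
    have hcomm := Function.update_comm huv' s t y
    have hu : ∀ z, offers waterWeight rankWeight x
        (Function.update (Function.update y u s) v t) z v =
        offers waterWeight rankWeight x (Function.update y v t) z v :=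
      fun z => by rw [offers_update_self, offers_update_self]
    have ha : ∀ z, ∀ a ∉ insert v ({u} : Set V), offers waterWeight rankWeight x
        (Function.update (Function.update y u s) v t) z a =
        offers waterWeight rankWeight x (Function.update y v t) z a := fun z a ha => by
      rw [offers_update_of_ne _ _ fun e => ha (Or.inl e),
        offers_update_of_ne _ _ fun e => ha (Or.inr e), offers_update_of_ne _ _ fun e => ha (Or.inl e)]
    exact ⟨fun h => h.congr ha fun z => (hu z).le,
      fun h => h.congr (fun z a h => (ha z a h).symm) fun z => (hu z).ge⟩
  refine pair_bound (σ := σ)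
    (P := fun s => Outbids I.graph (offers waterWeight rankWeight x (Function.update y u s)) {v} p u)
    (Q := fun t => Outbids I.graph (offers waterWeight rankWeight x (Function.update y v t)) {u} p v)
    (R := fun t => ∀ a ∈ freeRun I.graph o {u, v} p, I.graph.Adj u a →
      o u a < 1 - rankWeight t - waterWeight (x u v)) hb
    (fun s hs s' hs' hss => outbids_update_mono hs hs' hss)
    (fun s hs s' hs' hss => outbids_update_mono hs hs' hss)
    (fun t ht t' ht' htt h a ha hua => ?_) hσ0 (fun t ht hR => ?_) hint ?_
  · have := rankWeight_strictMonoOn_Icc.monotoneOn ht ht' htt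
    linarith [h a ha hua]
  · push Not at hR
    obtain ⟨a, ha, hua, hle⟩ := hR
    exact hle.trans (hσle a (Finset.mem_filter.2 ⟨ha, hua⟩))
  · filter_upwards [hgen] with ⟨s, t⟩ hy
    simp only at hy ⊢
    have hcases := pair_cases (p := p) hcol hy.2 hy.offers_nonneg (I.before_spec u) huv hv
      (σ := σ) (by
        rw [hfree]
        refine hσ.imp_right ?_
        rintro ⟨a, ha, h⟩
        rw [Finset.mem_filter] at ha
        exact ⟨a, ha.1, ha.2, by
          rw [h, hoff s t u a fun h => (mem_freeRun ha.1).1 h]⟩)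
    rw [hPiff, hQiff, hfree] at hcases
    set y' := Function.update (Function.update y u s) v t with hy'
    have hyu : y' u = s := by simp [hy', huv']
    have hyv : y' v = t := by simp [hy']
    have hs := rankWeight_mem (hyu ▸ hy.1 u)
    have ht := rankWeight_mem (hyv ▸ hy.1 v)
    have hact : 0 ≤ activeGain I waterWeight rankWeight x y' p u := activeGain_nonneg hy.offers_nonneg
    obtain ⟨hA, hB, hPn, hPQ⟩ := hcases
    unfold pairGain
    rw [← hp, hyu, hyv]
    have hA0 : (0 : ℝ) ≤ if (run I.graph waterWeight rankWeight x y' p).IsMatched u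
        then rankWeight s + 1 / 25 else 0 := by
      split_ifs <;> linarith
    have hB0 : (0 : ℝ) ≤ if (run I.graph waterWeight rankWeight x y'
        (p ++ [.deadline u])).IsMatched v then rankWeight t - 1 / 25 else 0 := by
      split_ifs <;> linarith
    refine ⟨fun hP => ?_, fun hP hQ => ?_, fun hP hQ => ?_, fun hP hQ hR => ?_, fun hP hQ hR => ?_⟩
    · rw [if_pos (hA hP)]
      linarith
    · rw [if_pos (hA hP), if_pos (hB hQ)]
      linarith
    · rw [if_pos (hB hQ)]
      rcases hPn hP with h | h
      · rw [if_pos h]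
        linarith [min_le_left (rankWeight s + 1 / 25) σ]
      · linarith [min_le_right (rankWeight s + 1 / 25) σ]
    · have hov : offers waterWeight rankWeight x y' u v = 1 - rankWeight t - waterWeight (x u v) :=
        offers_update_self _ _
      obtain ⟨h1, h2⟩ := (hPQ hP hQ).2 fun a ha hua => by
        rw [hov, ← hoff s t u a fun h => (mem_freeRun ha).1 h]
        exact hR a ha hua
      rw [if_pos h1]
      rw [hov] at h2
      linarith
    · linarith [(hPQ hP hQ).1]

variable [Fintype V]

open Classical in
/-- Redrawing two ranks does not change the law of the ranks. -/
theorem measurePreserving_update_update (u v : V) :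
    MeasurePreserving
      (fun q : (V → ℝ) × ℝ × ℝ => Function.update (Function.update q.1 u q.2.1) v q.2.2)
      ((rankMeasure V).prod (uniform.prod uniform)) (rankMeasure V) :=
  ((measurePreserving_update v).comp
    ((measurePreserving_update u).prod (MeasurePreserving.id uniform))).comp
      (measurePreserving_prodAssoc (rankMeasure V) uniform uniform).symm

open Classical in
/-- A lower bound for the conditional expectation given all but two ranks is a lower bound for the
expectation. -/
theorem le_integral_of_redraw {Ψ : (V → ℝ) → ℝ} (hΨ : Integrable Ψ (rankMeasure V)) (u v : V)
    {N : (V → ℝ) → Prop} (hN : ∀ᵐ y ∂rankMeasure V, N y) {c : ℝ}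
    (h : ∀ y, Integrable (fun q : ℝ × ℝ => Ψ (Function.update (Function.update y u q.1) v q.2))
        (uniform.prod uniform) →
      (∀ᵐ q ∂uniform.prod uniform, N (Function.update (Function.update y u q.1) v q.2)) →
      c ≤ ∫ q, Ψ (Function.update (Function.update y u q.1) v q.2) ∂uniform.prod uniform) :
    c ≤ ∫ y, Ψ y ∂rankMeasure V := by
  have hT := measurePreserving_update_update u v
  have hint : Integrable (fun q : (V → ℝ) × ℝ × ℝ =>
      Ψ (Function.update (Function.update q.1 u q.2.1) v q.2.2))
      ((rankMeasure V).prod (uniform.prod uniform)) := hT.integrable_comp_of_integrable hΨ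
  have hN' := Measure.ae_ae_of_ae_prod (hT.quasiMeasurePreserving.ae hN)
  have hmap : ∫ y, Ψ y ∂rankMeasure V = ∫ q : (V → ℝ) × ℝ × ℝ,
      Ψ (Function.update (Function.update q.1 u q.2.1) v q.2.2)
        ∂(rankMeasure V).prod (uniform.prod uniform) := by
    conv_lhs => rw [← hT.map_eq]
    exact integral_map hT.measurable.aemeasurable (by rw [hT.map_eq]; exact hΨ.1)
  rw [hmap, integral_prod _ hint]
  have hc : c = ∫ _y, c ∂rankMeasure V := by simp
  rw [hc]
  refine integral_mono_ae (integrable_const _) hint.integral_prod_left ?_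
  filter_upwards [hN', hint.prod_right_ae] with y h1 h2 using h y h2 h1

theorem ae_generic : ∀ᵐ y ∂rankMeasure V, Generic x y := by
  have : ∀ᵐ y ∂rankMeasure V, ∀ u, Function.Injective (offers waterWeight rankWeight x y u) := by
    rw [ae_all_iff]
    exact fun u => ae_injective_offer measurable_rankWeight rankWeight_strictMonoOn_Icc
      fun v => waterWeight (x u v)
  filter_upwards [ae_rank_mem, this] with y h1 h2 using ⟨h1, h2⟩

theorem integrable_rankWeight (v : V) :
    Integrable (fun y : V → ℝ => rankWeight (y v)) (rankMeasure V) := by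
  refine Integrable.of_bound
    (measurable_rankWeight.comp (measurable_pi_apply v)).aestronglyMeasurable 1 ?_
  filter_upwards [ae_rank_mem] with y hy
  have := rankWeight_mem (hy v)
  rw [Real.norm_eq_abs, abs_le]
  constructor <;> linarith

theorem integrable_activeGain (u : V) :
    Integrable (fun y => activeGain I waterWeight rankWeight x y (I.before u) u)
      (rankMeasure V) := by
  classical
  simp only [activeGain_eq_sum]
  refine integrable_finsetSum _ fun w _ =>
    integrable_ite (measurableSet_chosen measurable_rankWeight u _) ?_
  exact ((integrable_const _).sub (integrable_rankWeight w)).sub (integrable_const _)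

theorem integrable_gain (w : V) :
    Integrable (fun y => gain I waterWeight rankWeight x y w) (rankMeasure V) := by
  classical
  refine (integrable_activeGain w).add (integrable_finsetSum _ fun z _ =>
    integrable_ite (measurableSet_chosen measurable_rankWeight z _) ?_)
  exact (integrable_rankWeight w).add (integrable_const _)

theorem integrable_pairGain (u v : V) : Integrable (pairGain I x u v) (rankMeasure V) := by
  classical
  refine ((integrable_ite ?_ ?_).add (integrable_activeGain u)).add (integrable_ite ?_ ?_)
  · exact measurableSet_run measurable_rankWeight _ fun S => S.IsMatched u
  · exact (integrable_rankWeight u).add (integrable_const _)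
  · exact measurableSet_run measurable_rankWeight _ fun S => S.IsMatched v
  · exact (integrable_rankWeight v).sub (integrable_const _)

theorem isLookahead_nonneg {f g : ℝ → ℝ} (hx : IsLookahead f g I x) (u v : V) : 0 ≤ x u v := by
  rw [isLookahead_row hx (I.before_spec u) v]
  exact measureReal_nonneg

/-- The constants 1/25 come from the water levels. The tangent bound for `u` yields a bonus of 1/25
when `u` is matched early, at the cost of 1/125. For `v`, a share of 1/25 is taken out of its gain
whenever it is matched by the deadline of `u`, and is returned in expectation as `x u v / 25`. -/
theorem edge_bound (hx : IsLookahead waterWeight rankWeight I x) {col : V → Bool}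
    (hcol : ∀ u v, I.graph.Adj u v → col u ≠ col v) {u v : V} (huv : I.graph.Adj u v)
    (hv : OnlineEvent.deadline v ∉ I.before u) :
    569 / 1000 ≤ (∫ y, gain I waterWeight rankWeight x y u ∂rankMeasure V) +
      ∫ y, gain I waterWeight rankWeight x y v ∂rankMeasure V := by
  classical
  have hspec := I.before_spec u
  have hvd : OnlineEvent.deadline v ∉ I.before u ++ [.deadline u] := by
    simp [hv, huv.ne']
  have hpair := le_integral_of_redraw (integrable_pairGain (I := I) (x := x) u v) u v
    (ae_generic (x := x))
    (c := 569 / 1000 - (waterPrimitive (x u v) + x u v / 25 - 1 / 125)) fun y h1 h2 => by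
      have := pairGain_bound hcol huv hv (isLookahead_nonneg hx u v) y h1 h2
      linarith
  have hLu := waterPrimitive_le_integral_levelGain measurable_rankWeight hx
    (prefix_of_append hspec) (notMem_of_prefix hspec)
  have hLv := waterPrimitive_le_integral_levelGain measurable_rankWeight hx hspec hvd
  rw [← isLookahead_row hx hspec v] at hLv
  have htan := waterPrimitive_tangent ((rankMeasure V).real
    {y | (run I.graph waterWeight rankWeight x y (I.before u)).IsMatched u})
  have hmA := measurableSet_run (G := I.graph) (f := waterWeight) (x := x) measurable_rankWeight
    (I.before u) fun S => S.IsMatched u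
  have hmB := measurableSet_run (G := I.graph) (f := waterWeight) (x := x) measurable_rankWeight
    (I.before u ++ [.deadline u]) fun S => S.IsMatched v
  have hA := integral_ite_const hmA (1 / 25)
  have hB := integral_ite_const hmB (1 / 25)
  rw [← isLookahead_row hx hspec v] at hB
  have hiA := integrable_ite hmA (integrable_const (1 / 25 : ℝ))
  have hiB := integrable_ite hmB (integrable_const (1 / 25 : ℝ))
  have hiLu := integrable_levelGain (I := I) (f := waterWeight) (x := x) (p := I.before u)
    measurable_rankWeight u
  have hiLv := integrable_levelGain (I := I) (f := waterWeight) (x := x)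
    (p := I.before u ++ [.deadline u]) measurable_rankWeight v
  have hi₁ : Integrable (fun y => pairGain I x u v y
      + levelGain I waterWeight rankWeight x y (I.before u) u) (rankMeasure V) :=
    (integrable_pairGain u v).add hiLu
  have hi₂ : Integrable (fun y => pairGain I x u v y
      + levelGain I waterWeight rankWeight x y (I.before u) u
      + levelGain I waterWeight rankWeight x y (I.before u ++ [.deadline u]) v) (rankMeasure V) :=
    hi₁.add hiLv
  have hi₃ : Integrable (fun y => pairGain I x u v y
      + levelGain I waterWeight rankWeight x y (I.before u) u
      + levelGain I waterWeight rankWeight x y (I.before u ++ [.deadline u]) v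
      + (if (run I.graph waterWeight rankWeight x y
          (I.before u ++ [.deadline u])).IsMatched v then (1 / 25 : ℝ) else 0)) (rankMeasure V) :=
    hi₂.add hiB
  have hle : ∫ y, (pairGain I x u v y
      + levelGain I waterWeight rankWeight x y (I.before u) u
      + levelGain I waterWeight rankWeight x y (I.before u ++ [.deadline u]) v
      + (if (run I.graph waterWeight rankWeight x y
          (I.before u ++ [.deadline u])).IsMatched v then (1 / 25 : ℝ) else 0)
      - (if (run I.graph waterWeight rankWeight x y (I.before u)).IsMatched u
          then (1 / 25 : ℝ) else 0)) ∂rankMeasure V ≤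
      ∫ y, (gain I waterWeight rankWeight x y u + gain I waterWeight rankWeight x y v)
        ∂rankMeasure V := by
    refine integral_mono_ae (hi₃.sub hiA)
      ((integrable_gain u).add (integrable_gain v)) ?_
    filter_upwards [ae_generic (x := x)] with y hy
    have hf : ∀ u v, 0 ≤ waterWeight (x u v) := fun u v =>
      waterWeight_nonneg (isLookahead_nonneg hx u v)
    have hg : ∀ w, 0 ≤ rankWeight (y w) := fun w => by
      linarith [(rankWeight_mem (hy.1 w)).1]
    have h1 := gain_lower (g := rankWeight) hf (hg u) (prefix_of_append hspec)
      (notMem_of_prefix hspec)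
    have h2 := gain_lower (g := rankWeight) hf (hg v) hspec hvd
    have h3 : 0 ≤ activeGain I waterWeight rankWeight x y (I.before v) v :=
      activeGain_nonneg hy.offers_nonneg
    simp only [pairGain]
    split_ifs at h1 h2 ⊢ <;> linarith
  rw [integral_sub hi₃ hiA, integral_add hi₂ hiB, integral_add hi₁ hiLv,
    integral_add (integrable_pairGain u v) hiLu,
    integral_add (integrable_gain u) (integrable_gain v), hA, hB] at hle
  linarith

/-- Weak duality: a fractional vertex cover scaled by `c` bounds every matching. -/
theorem mul_ncard_le_sum_of_matching {G : SimpleGraph V} {M : G.Subgraph} (hM : M.IsMatching)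
    {a : V → ℝ} (ha : ∀ w, 0 ≤ a w) {c : ℝ} (h : ∀ u v, G.Adj u v → c ≤ a u + a v) :
    c * (M.edgeSet.ncard : ℝ) ≤ ∑ w, a w := by
  classical
  rw [Set.ncard_eq_toFinset_card' M.edgeSet]
  have hdisj : ∀ e ∈ M.edgeSet.toFinset, ∀ e' ∈ M.edgeSet.toFinset, e ≠ e' →
      Disjoint e.toFinset e'.toFinset := by
    intro e he e' he' hne
    rw [Finset.disjoint_left]
    intro w hw hw'
    rw [Sym2.mem_toFinset] at hw hw'
    obtain ⟨b, rfl⟩ := hw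
    obtain ⟨b', rfl⟩ := hw'
    rw [Set.mem_toFinset, SimpleGraph.Subgraph.mem_edgeSet] at he he'
    exact hne (by rw [hM.eq_of_adj_left he he'])
  calc c * (M.edgeSet.toFinset.card : ℝ) = ∑ _e ∈ M.edgeSet.toFinset, c := by
        rw [Finset.sum_const, nsmul_eq_mul, mul_comm]
    _ ≤ ∑ e ∈ M.edgeSet.toFinset, ∑ w ∈ e.toFinset, a w := by
        refine Finset.sum_le_sum fun e he => ?_
        induction e using Sym2.ind with
        | _ u v =>
          rw [Set.mem_toFinset, SimpleGraph.Subgraph.mem_edgeSet] at he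
          have huv := M.adj_sub he
          rw [Sym2.toFinset_mk_eq, Finset.sum_pair huv.ne]
          exact h u v huv
    _ = ∑ w ∈ M.edgeSet.toFinset.biUnion Sym2.toFinset, a w :=
        (Finset.sum_biUnion hdisj).symm
    _ ≤ ∑ w, a w := Finset.sum_le_sum_of_subset_of_nonneg (Finset.subset_univ _)
        fun w _ _ => ha w

end BalancedRanking


theorem theorem1 :
    ∃ f g : ℝ → ℝ, BalancedRanking.Admissible f g ∧
      ∀ (V : Type*) [Fintype V] (I : FullyOnlineInstance V), I.graph.IsBipartite →
        (∃! x : V → V → ℝ, BalancedRanking.IsLookahead f g I x) ∧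
        ∀ x : V → V → ℝ, BalancedRanking.IsLookahead f g I x →
          ∀ M : I.graph.Subgraph, M.IsMatching →
            (0.569 : ℝ) * (M.edgeSet.ncard : ℝ) ≤ BalancedRanking.expectedSize f g I x := by
  refine ⟨BalancedRanking.waterWeight, BalancedRanking.rankWeight, BalancedRanking.admissible,
    fun V _ I hI => ⟨?_, fun x hx M hM => ?_⟩⟩
  · obtain ⟨x, hx⟩ := BalancedRanking.exists_isLookahead (I := I)
      BalancedRanking.measurable_rankWeight BalancedRanking.rankWeight_strictMonoOn_Icc
      BalancedRanking.continuous_waterWeight BalancedRanking.waterWeight_mono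
    exact ⟨x, hx, fun x' hx' => BalancedRanking.isLookahead_unique
      BalancedRanking.measurable_rankWeight BalancedRanking.rankWeight_strictMonoOn_Icc
      BalancedRanking.waterWeight_mono hx' hx⟩
  · obtain ⟨C⟩ := hI
    have hcol : ∀ u v, I.graph.Adj u v → finTwoEquiv (C u) ≠ finTwoEquiv (C v) :=
      fun u v h => finTwoEquiv.injective.ne (C.valid h)
    have hsize : BalancedRanking.expectedSize BalancedRanking.waterWeight
        BalancedRanking.rankWeight I x = ∑ w, ∫ y, BalancedRanking.gain I
          BalancedRanking.waterWeight BalancedRanking.rankWeight x y w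
            ∂BalancedRanking.rankMeasure V := by
      rw [← integral_finsetSum _ fun w _ => BalancedRanking.integrable_gain w]
      simp only [BalancedRanking.sum_gain]
      rfl
    rw [hsize]
    refine BalancedRanking.mul_ncard_le_sum_of_matching hM (fun w => ?_) fun u v huv => ?_
    · refine integral_nonneg_of_ae ?_
      filter_upwards [BalancedRanking.ae_generic (x := x)] with y hy
      exact BalancedRanking.gain_nonneg hy.offers_nonneg
        (fun u v => BalancedRanking.waterWeight_nonneg (BalancedRanking.isLookahead_nonneg hx u v))
        (by linarith [(BalancedRanking.rankWeight_mem (hy.1 w)).1])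
    · have h569 : (0.569 : ℝ) = 569 / 1000 := by norm_num
      rw [h569]
      -- The edge estimate is asymmetric: its first vertex must be the one that departs first.
      rcases I.deadline_notMem_before u v with h | h
      · exact BalancedRanking.edge_bound hx hcol huv h
      · rw [add_comm]
        exact BalancedRanking.edge_bound hx hcol huv.symm h
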